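/- **Setting.** For $k\ge 0$ let $\mathbb P^k$ and $\mathbb Q^k$ be the real polynomials in two variables of total degree $\le k$, respectively of degree $\le k$ in each variable. Let $Q=\left]0,1\right[^2$, $0<\lambda<1$, $N\ge1$, and let $G^0_1,\dots,G^0_N$ be polynomial maps with components in $\mathbb Q^q$ for some $q$, injective and with invertible Jacobian matrix on $Q$. Put $G^i_n=\lambda^iG^0_n$ and assume that the sets $G^i_n(Q)$, $i\ge0$, $1\le n\le N$, are pairwise disjoint. Let $\Omega$ be the interior of the closure of $\bigcup_{i,n}G^i_n(Q)$. Let $\mathcal M^k_{(i)}$ consist of all elements $\omega=G^i_n(b)$, $1\le n\le N$, where $b$ runs through the $4^k$ open dyadic squares of side $2^{-k}$ in $Q$; on such an element, for fixed $p\ge 0$, put $\mathcal S[p;\omega]=\{\varphi:\omega\to\mathbb R:\ \varphi\circ G^i_n|_b\in\mathbb Q^p\}$. The mesh of level $\ell\ge 0$ is $$\mathcal M^\ell_*=\bigcup_{i=0}^{\ell}\mathcal M^{\ell-i}_{(i)}\cup\{\omega^{\ell+1}_*\},\qquad \omega^{\ell+1}_*=\lambda^{\ell+1}\Omega .$$ On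 the cap $\omega^1_*=\lambda\Omega$ any finite-dimensional space $\mathcal S[p;\omega^1_*]\subset L^2(\omega^1_*)$ is given, and $\mathcal S[p;\omega_*^{\ell+1}]=\{s(\lambda^{-\ell}\,\cdot): s\in\mathcal S[p;\omega^1_*]\}$ is its scaled copy. For a mesh $\mathcal M$, $\mathcal S[p;\mathcal M]$ is the space of all square integrable functions whose restriction to each $\omega\in\mathcal M$ lies in $\mathcal S[p;\omega]$; write $$|f|_{r,\mathcal M}=\Big(\sum_{\omega\in\mathcal M}\ \sum_{a+b=r}\|\partial_x^a\partial_y^bf\|^2_{L^2(\omega)}\Big)^{1/2},\qquad E_r(\varphi;\mathcal M)=\inf_{\varphi_h\in\mathcal S[p;\mathcal M]}|\varphi-\varphi_h|_{r,\mathcal M}$$ (weak derivatives; the seminorm is $\infty$ if they do not exist in $L^2$ on some element). The reproduction degree of an element $\omega$ is the largest $\kappa$ with $\mathbb P^\kappa\subseteq\mathcal S[p;\omega]$. Let $\underline\kappa_0$ be the smallest reproduction degree of the elements $G^0_n(Q)$, $1\le n\le N$, and assume $\mathbb P^{\underline\kappa_0}\subseteq\mathcal S[p;\omega^1_*]$.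 Let $\mathbb P_{\max}$ be the space of homogeneous polynomials of degree $\underline\kappa_0+1$ and, for an integer $0\le r\le\underline\kappa_0+1$, $$\underline C_0^r=\sup_{0\ne\varphi\in\mathbb P_{\max}}\frac{E_r(\varphi;\mathcal M^0_*)}{\|\varphi\|_{H^{p+1}(\Omega)}}.$$ **Theorem.** Let $A=\lambda^{\underline\kappa_0+2-r}$ and $B=2^{-(p+1-r)}$. Then $0<\underline C_0^r<\infty$, and the supremum is attained at some $\varphi\in\mathbb P_{\max}$ with $\|\varphi\|_{H^{p+1}(\Omega)}=1$. Let $\varphi^{r,*}$ be any such maximizer with norm $1$. 1. If $\varphi^{r,*}\notin\mathcal S[p;G^0_n(Q)]$ for at least one $n$, then there is a constant $\underline c^r>0$ such that for all $\ell\ge0$ $$E_r(\varphi^{r,*};\mathcal M^\ell_{(0)})\ \ge\ \underline c^r\,B^{\ell}\,\underline C^r_0.\tag{$*$}$$ 2. For every constant $\underline c^r\ge0$ that satisfies $(*)$ for all $\ell\ge0$, and for every $\ell\ge 0$, $$E_r(\varphi^{r,*};\mathcal M^\ell_*)\ \ge\ \min(1,\underline c^r)\,\underline C_0^r\Big(\sum_{i=0}^{\ell}A^{2i}B^{2(\ell-i)}\Big)^{1/2}.$$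 3. For every $\ell\ge0$, $E_r(\varphi^{r,*};\mathcal M^\ell_*)\ge\underline C_0^r\,\lambda^{\ell(\underline\kappa_0+2-r)}$. Hence, if $A>B$, there is no $K$ with $E_r(\varphi^{r,*};\mathcal M^\ell_*)\le K\,2^{-\ell(p+1-r)}$ for all $\ell$: the optimal rate is not reached. -/

import Mathlib

open MeasureTheory

noncomputable section

/-- The plane with coordinates `x = v 0`, `y = v 1`. Its `volume` is the Lebesgue measure. -/
abbrev Plane : Type := Fin 2 → ℝ

/-- Real polynomials in two variables. -/
abbrev Poly2 : Type := MvPolynomial (Fin 2) ℝ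

/-- The function on the plane given by a polynomial. -/
def polyFun (P : Poly2) : Plane → ℝ := fun x => MvPolynomial.eval x P

/-- The map of the plane whose components are two polynomials. -/
def polyMap (P : Fin 2 → Poly2) : Plane → Plane := fun u a => MvPolynomial.eval u (P a)

/-- The dyadic square `]j₁/2^k, (j₁+1)/2^k[ × ]j₂/2^k, (j₂+1)/2^k[`. -/
def dyadicSquare (k j₁ j₂ : ℕ) : Set Plane :=
  {u | (j₁ : ℝ) / 2 ^ k < u 0 ∧ u 0 < ((j₁ : ℝ) + 1) / 2 ^ k ∧
       (j₂ : ℝ) / 2 ^ k < u 1 ∧ u 1 < ((j₂ : ℝ) + 1) / 2 ^ k}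

/-- The open unit square `B = ]0,1[²`. -/
def unitSquare : Set Plane := {u | 0 < u 0 ∧ u 0 < 1 ∧ 0 < u 1 ∧ u 1 < 1}

/-! ### Sobolev seminorms through weak derivatives -/

/-- Classical partial derivative in the coordinate direction `k`. -/
def partialDeriv (k : Fin 2) (f : Plane → ℝ) : Plane → ℝ :=
  fun x => fderiv ℝ f x (Pi.single k 1)

/-- The iterated partial derivative `∂_x^{α.1} ∂_y^{α.2} f`. -/
def multiDeriv (α : ℕ × ℕ) (f : Plane → ℝ) : Plane → ℝ :=
  (partialDeriv 0)^[α.1] ((partialDeriv 1)^[α.2] f)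

/-- `g` is a weak derivative of `f` on the open set `U` for the multi-index `α`. -/
def IsWeakDeriv (U : Set Plane) (α : ℕ × ℕ) (f g : Plane → ℝ) : Prop :=
  LocallyIntegrableOn f U ∧ LocallyIntegrableOn g U ∧
    ∀ ψ : Plane → ℝ, ContDiff ℝ ((⊤ : ℕ∞) : WithTop ℕ∞) ψ → HasCompactSupport ψ →
      tsupport ψ ⊆ U →
        ∫ x in U, f x * multiDeriv α ψ x = (-1) ^ (α.1 + α.2) * ∫ x in U, g x * ψ x

/-- The squared seminorm `|f|²_{H^r(U)} = ∑_{a+b=r} ‖∂_x^a ∂_y^b f‖²_{L²(U)}`. Weak derivatives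
are unique almost everywhere, so the infimum ranges over one value at most; it is `∞` when
some weak derivative of order `r` does not exist or is not square integrable. -/
def sobolevSemiSq (r : ℕ) (U : Set Plane) (f : Plane → ℝ) : ENNReal :=
  ⨅ (g : ℕ × ℕ → Plane → ℝ) (_ : ∀ α ∈ Finset.HasAntidiagonal.antidiagonal r, IsWeakDeriv U α f (g α)),
    ∑ α ∈ Finset.HasAntidiagonal.antidiagonal r, ∫⁻ x in U, ‖g α x‖ₑ ^ 2

/-- The norm `‖f‖_{H^k(U)} = (∑_{σ ≤ k} |f|²_{H^σ(U)})^{1/2}`. -/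
def sobolevNorm (k : ℕ) (U : Set Plane) (f : Plane → ℝ) : ENNReal :=
  (∑ σ ∈ Finset.range (k + 1), sobolevSemiSq σ U f) ^ (1 / 2 : ℝ)

/-! ### Meshes and broken spaces -/

/-- A mesh element together with its local space. Local spaces are given as sets of functions on
the plane, membership depending only on the values on the element. -/
structure MeshElement where
  dom : Set Plane
  space : Set (Plane → ℝ)

/-- The degrees `k` with `ℙ^k ⊆ 𝒮[ω]`. The reproduction degree is the largest of them. -/
def MeshElement.reproducedDegrees (ω : MeshElement) : Set ℕ :=
  {k | ∀ P ∈ MvPolynomial.restrictTotalDegree (Fin 2) ℝ k, polyFun P ∈ ω.space}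

/-- The functions that are square integrable over the union of the elements (which differs from
the meshed domain by the skeleton only, a null set) and lie in every local space. -/
def meshSpace {ι : Type} (M : ι → MeshElement) : Set (Plane → ℝ) :=
  {f | MemLp f 2 (volume.restrict (⋃ e, (M e).dom)) ∧ ∀ e, f ∈ (M e).space}

/-- The broken seminorm `(∑_ω |f|²_{H^r(ω)})^{1/2}`. -/
def brokenSemi {ι : Type} [Fintype ι] (r : ℕ) (M : ι → MeshElement) (f : Plane → ℝ) : ENNReal :=
  (∑ e, sobolevSemiSq r (M e).dom f) ^ (1 / 2 : ℝ)

/-- The best approximation error of `f` from the mesh space in the broken seminorm. -/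
def bestError {ι : Type} [Fintype ι] (r : ℕ) (M : ι → MeshElement) (f : Plane → ℝ) : ENNReal :=
  ⨅ fh ∈ meshSpace M, brokenSemi r M (fun x => f x - fh x)

/-! ### Self-similar domains -/

/-- Self-similar geometry: `N` regular element parameterizations of bi-degree `(q,q)` for the
initial ring, and a scaling factor `lam`. The parameterizations of the ring number `i` are the
initial ones scaled by `lam ^ i`; all the elements of all rings are pairwise disjoint. -/
structure SelfSimilarGeometry where
  N : ℕ
  N_pos : 0 < N
  q : ℕ
  lam : ℝ
  lam_pos : 0 < lam
  lam_lt_one : lam < 1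
  /-- The two polynomial components of each initial parameterization. -/
  G : Fin N → Fin 2 → Poly2
  G_degree : ∀ n a, G n a ∈ MvPolynomial.restrictDegree (Fin 2) ℝ q
  G_injOn : ∀ n, Set.InjOn (polyMap (G n)) unitSquare
  /-- The Jacobian matrix is invertible at each point of the open unit square. -/
  G_regular : ∀ n, ∀ u ∈ unitSquare,
    (Matrix.of fun a b => MvPolynomial.eval u (MvPolynomial.pderiv b (G n a))).det ≠ 0
  disjoint : ∀ (i i' : ℕ) (n n' : Fin N), (i, n) ≠ (i', n') →
    Disjoint ((fun u => lam ^ i • polyMap (G n) u) '' unitSquare)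
      ((fun u => lam ^ i' • polyMap (G n') u) '' unitSquare)

namespace SelfSimilarGeometry

variable (D : SelfSimilarGeometry)

/-- The parameterization of the element number `n` of the ring number `i`. -/
def param (i : ℕ) (n : Fin D.N) : Plane → Plane := fun u => D.lam ^ i • polyMap (D.G n) u

/-- The domain, the interior of the closure of the union of all elements of all rings. -/
def Omega : Set Plane := interior (closure (⋃ (i : ℕ) (n : Fin D.N), D.param i n '' unitSquare))

/-- The element with domain `G^i_n(b)`, with the space of all functions `f` on it such that
`f ∘ G^i_n` is on `b` a polynomial of degree at most `p` in each variable. -/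
def element (p i : ℕ) (n : Fin D.N) (b : Set Plane) : MeshElement where
  dom := D.param i n '' b
  space := {f | ∃ Q ∈ MvPolynomial.restrictDegree (Fin 2) ℝ p,
    ∀ u ∈ b, f (D.param i n u) = polyFun Q u}

/-- The mesh obtained from the elements of the ring number `i` by `k` bisections. -/
def ringMesh (p i k : ℕ) : Fin D.N × Fin (2 ^ k) × Fin (2 ^ k) → MeshElement :=
  fun e => D.element p i e.1 (dyadicSquare k e.2.1 e.2.2)

/-- The cap `lam^(ℓ+1) Ω` at level `ℓ`. Its local space is the scaled copy of the given space `W`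
of functions on the initial cap `lam Ω`. -/
def cap (W : Submodule ℝ (Plane → ℝ)) (l : ℕ) : MeshElement where
  dom := (fun x => D.lam ^ (l + 1) • x) '' D.Omega
  space := {f | ∃ s ∈ W, ∀ x ∈ (fun x => D.lam ^ (l + 1) • x) '' D.Omega,
    f x = s ((D.lam ^ l)⁻¹ • x)}

/-- The global mesh at level `ℓ`: the rings `0 ≤ i ≤ ℓ`, the ring number `i` being bisected
`ℓ - i` times, and the cap. -/
def globalMesh (p : ℕ) (W : Submodule ℝ (Plane → ℝ)) (l : ℕ) :
    Option (Σ i : Fin (l + 1), Fin D.N × Fin (2 ^ (l - (i : ℕ))) × Fin (2 ^ (l - (i : ℕ)))) →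
      MeshElement
  | none => D.cap W l
  | some e => D.ringMesh p e.1 (l - (e.1 : ℕ)) e.2

/-- `κ` is the smallest of the reproduction degrees of the initial elements. -/
def IsMinReproductionDegree (p κ : ℕ) : Prop :=
  IsLeast {k | ∃ n : Fin D.N, IsGreatest (D.element p 0 n unitSquare).reproducedDegrees k} κ

/-- The supremum over the nonzero homogeneous polynomials `P` of degree `κ + 1` of the best
approximation error of `P` on the initial mesh, divided by `‖P‖_{H^{p+1}(Ω)}`. -/
def extremalConst (p κ : ℕ) (W : Submodule ℝ (Plane → ℝ)) (r : ℕ) : ENNReal :=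
  ⨆ (P : Poly2) (_ : P ∈ MvPolynomial.homogeneousSubmodule (Fin 2) ℝ (κ + 1)) (_ : P ≠ 0),
    bestError r (D.globalMesh p W 0) (polyFun P) / sobolevNorm (p + 1) D.Omega (polyFun P)

/-- A normalized homogeneous polynomial of degree `κ + 1` at which the supremum is attained. -/
def IsExtremal (p κ : ℕ) (W : Submodule ℝ (Plane → ℝ)) (r : ℕ) (φ : Poly2) : Prop :=
  φ ∈ MvPolynomial.homogeneousSubmodule (Fin 2) ℝ (κ + 1) ∧
    sobolevNorm (p + 1) D.Omega (polyFun φ) = 1 ∧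
    bestError r (D.globalMesh p W 0) (polyFun φ) = D.extremalConst p κ W r

/-- `c` is a constant in the lower bound `c 2^{-ℓ(p+1-r)} C₀` for the error on the initial ring,
at all levels `ℓ`. -/
def IsRingConst (p κ : ℕ) (W : Submodule ℝ (Plane → ℝ)) (r : ℕ) (φ : Poly2) (c : ℝ) : Prop :=
  ∀ l : ℕ, ENNReal.ofReal (c * ((1 / 2 : ℝ) ^ l) ^ ((p : ℤ) + 1 - r)) * D.extremalConst p κ W r ≤
    bestError r (D.ringMesh p 0 l) (polyFun φ)

end SelfSimilarGeometry

end

noncomputable section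

open Set Filter Topology
open scoped ContDiff ENNReal

/-! ### Classical partial derivatives -/

/-! The proof combines three arguments: scaling, compactness and an inverse inequality.

Scaling. Let `φ` be homogeneous of degree `d = κ₀ + 1`. For an approximant `f` and `c > 0`,
homogeneity gives `φ - c⁻ᵈ f(c ·) = c⁻ᵈ (φ - f)(c ·)`. The area, the factor `cᵈ` and the `r`
derivatives together scale the seminorm by `c ^ (d + 1 - r)`, which for `c = λ ^ i` is `A ^ i`. The
dilation `λ ^ i` carries the initial ring with `k` bisections to ring `i` with `k` bisections. The
dilation `λ ^ l` carries the level-0 mesh to the last ring together with the cap. Any approximant at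
level `l` therefore restricts and rescales to competitors for these reference problems
(`bestError_ringMesh_scaling`, `bestError_globalMesh_scaling`). Squared errors add over elements:
ring `i < l` contributes `A ^ (2 * i)` times the squared ring error after `l - i` bisections, while
the last ring and the cap contribute `A ^ (2 * l)` times the squared level-0 error. Keeping
everything gives claim 2 (`sqrt_sum_mul_bestError_le`); keeping only the last contribution gives
claim 3 (`pow_mul_bestError_le`), and `A > B` then excludes the rate `B ^ l`.

Compactness. On the finite-dimensional space of homogeneous polynomials the best error is a finite
seminorm and the Sobolev norm is a norm, so the quotient attains its maximum on the unit sphere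
(`exists_isExtremal`). The maximum is positive as soon as one homogeneous polynomial has positive
error.

Inverse inequality. This is the substance of claim 1 and also yields that positivity
(`exists_ring_lower_bound`). If `φ ∘ G` is not in `ℚ^p`, some `∂_a^(p+1)` does not annihilate it,
although it annihilates every local approximant. By the chain rule `∂_a^(p+1) (f ∘ G)` is a
combination of `(∂^α f) ∘ G` with `|α| ≤ p + 1` and polynomial coefficients. The coefficients with
`|α| < r` vanish, because polynomials of degree below `r` are reproduced. Weighted by powers of the
Jacobian determinant `J`, the derivatives of the error become polynomials of bounded degree in `u`,
and on dyadic squares of side `2⁻ˡ` each order beyond `r` costs a factor `2 ^ l`. Thus a fixed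
positive quantity, the norm of `J ^ (2p+3) ∂_a^(p+1) (φ ∘ G)`, is at most a constant times `2 ^
(l(p+1-r))` times the error. The weights also deal with a Jacobian that may degenerate at the
boundary of the square. -/

lemma partialDeriv_eqOn {U : Set Plane} (hU : IsOpen U) {f g : Plane → ℝ} (h : EqOn f g U)
    (k : Fin 2) : EqOn (partialDeriv k f) (partialDeriv k g) U := fun x hx => by
  have : f =ᶠ[𝓝 x] g := Filter.eventuallyEq_of_mem (hU.mem_nhds hx) h
  simp only [partialDeriv, this.fderiv_eq]

lemma iterate_partialDeriv_eqOn {U : Set Plane} (hU : IsOpen U) {f g : Plane → ℝ}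
    (h : EqOn f g U) (k : Fin 2) (n : ℕ) :
    EqOn ((partialDeriv k)^[n] f) ((partialDeriv k)^[n] g) U := by
  induction n with
  | zero => simpa using h
  | succ n ih =>
    simp only [Function.iterate_succ_apply']
    exact partialDeriv_eqOn hU ih k

lemma contDiffOn_partialDeriv {U : Set Plane} (hU : IsOpen U) {f : Plane → ℝ}
    (hf : ContDiffOn ℝ ∞ f U) (k : Fin 2) : ContDiffOn ℝ ∞ (partialDeriv k f) U :=
  (hf.fderiv_of_isOpen hU (m := ∞) le_rfl).clm_apply contDiffOn_const

lemma contDiffOn_iterate_partialDeriv {U : Set Plane} (hU : IsOpen U) {f : Plane → ℝ}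
    (hf : ContDiffOn ℝ ∞ f U) (k : Fin 2) (n : ℕ) :
    ContDiffOn ℝ ∞ ((partialDeriv k)^[n] f) U := by
  induction n with
  | zero => simpa using hf
  | succ n ih =>
    simp only [Function.iterate_succ_apply']
    exact contDiffOn_partialDeriv hU ih k

lemma contDiffOn_multiDeriv {U : Set Plane} (hU : IsOpen U) {f : Plane → ℝ}
    (hf : ContDiffOn ℝ ∞ f U) (α : ℕ × ℕ) : ContDiffOn ℝ ∞ (multiDeriv α f) U :=
  contDiffOn_iterate_partialDeriv hU (contDiffOn_iterate_partialDeriv hU hf _ _) _ _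

lemma differentiableAt_of_contDiffOn {U : Set Plane} (hU : IsOpen U) {f : Plane → ℝ}
    (hf : ContDiffOn ℝ ∞ f U) {x : Plane} (hx : x ∈ U) : DifferentiableAt ℝ f x :=
  (hf.differentiableOn (by simp) x hx).differentiableAt (hU.mem_nhds hx)

lemma partialDeriv_comm {U : Set Plane} (hU : IsOpen U) {f : Plane → ℝ}
    (hf : ContDiffOn ℝ ∞ f U) (j k : Fin 2) :
    EqOn (partialDeriv j (partialDeriv k f)) (partialDeriv k (partialDeriv j f)) U := by
  intro x hx
  have hfx : ContDiffAt ℝ ∞ f x := hf.contDiffAt (hU.mem_nhds hx)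
  have hs : IsSymmSndFDerivAt ℝ f x := hfx.isSymmSndFDerivAt (by simp; exact WithTop.coe_le_coe.2 le_top)
  have hd : DifferentiableAt ℝ (fderiv ℝ f) x :=
    ((hfx.fderiv_right (m := ∞) le_rfl).differentiableAt (by simp))
  have key : ∀ a b : Fin 2, partialDeriv a (partialDeriv b f) x =
      fderiv ℝ (fderiv ℝ f) x (Pi.single a 1) (Pi.single b 1) := fun a b => by
    change fderiv ℝ (fun y => fderiv ℝ f y (Pi.single b 1)) x (Pi.single a 1) = _
    rw [fderiv_clm_apply hd (differentiableAt_const _)]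
    simp
  rw [key, key]
  exact hs _ _

lemma partialDeriv_iterate_comm {U : Set Plane} (hU : IsOpen U) {f : Plane → ℝ}
    (hf : ContDiffOn ℝ ∞ f U) (j k : Fin 2) (n : ℕ) :
    EqOn (partialDeriv j ((partialDeriv k)^[n] f)) ((partialDeriv k)^[n] (partialDeriv j f)) U := by
  induction n with
  | zero => exact fun x _ => rfl
  | succ n ih =>
    simp only [Function.iterate_succ_apply']
    exact (partialDeriv_comm hU (contDiffOn_iterate_partialDeriv hU hf k n) j k).trans
      (partialDeriv_eqOn hU ih k)

lemma partialDeriv_zero_multiDeriv (α : ℕ × ℕ) (f : Plane → ℝ) :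
    partialDeriv 0 (multiDeriv α f) = multiDeriv (α + (1, 0)) f := by
  simp only [multiDeriv, Prod.fst_add, Prod.snd_add, add_zero, Function.iterate_succ_apply']

/-- In `multiDeriv` the `x`-derivatives are outermost, so an additional `y`-derivative has to be
moved past them by symmetry of second derivatives. -/
lemma partialDeriv_one_multiDeriv {U : Set Plane} (hU : IsOpen U) {f : Plane → ℝ}
    (hf : ContDiffOn ℝ ∞ f U) (α : ℕ × ℕ) :
    EqOn (partialDeriv 1 (multiDeriv α f)) (multiDeriv (α + (0, 1)) f) U := by
  simp only [multiDeriv, Prod.fst_add, Prod.snd_add, add_zero, Function.iterate_succ_apply']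
  exact partialDeriv_iterate_comm hU (contDiffOn_iterate_partialDeriv hU hf _ _) _ _ _

/-- The multi-index of the coordinate direction `k`. -/
def unitIndex (k : Fin 2) : ℕ × ℕ := if k = 0 then (1, 0) else (0, 1)

lemma partialDeriv_multiDeriv {U : Set Plane} (hU : IsOpen U) {f : Plane → ℝ}
    (hf : ContDiffOn ℝ ∞ f U) (α : ℕ × ℕ) (k : Fin 2) :
    EqOn (partialDeriv k (multiDeriv α f)) (multiDeriv (α + unitIndex k) f) U := by
  fin_cases k
  · simp only [unitIndex]
    intro x _
    exact congrFun (partialDeriv_zero_multiDeriv α f) x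
  · exact partialDeriv_one_multiDeriv hU hf α

/-! ### Test functions -/

/-- Smooth functions with compact support in `U`. -/
structure IsTestFun (U : Set Plane) (ψ : Plane → ℝ) : Prop where
  contDiff : ContDiff ℝ ∞ ψ
  hasCompactSupport : HasCompactSupport ψ
  subset : tsupport ψ ⊆ U

lemma support_partialDeriv_subset (k : Fin 2) (ψ : Plane → ℝ) :
    Function.support (partialDeriv k ψ) ⊆ tsupport ψ := fun x hx => by
  by_contra h
  apply hx
  have : ψ =ᶠ[𝓝 x] fun _ => 0 := notMem_tsupport_iff_eventuallyEq.1 h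
  simp [partialDeriv, this.fderiv_eq]

lemma tsupport_partialDeriv_subset (k : Fin 2) (ψ : Plane → ℝ) :
    tsupport (partialDeriv k ψ) ⊆ tsupport ψ :=
  closure_minimal (support_partialDeriv_subset k ψ) (isClosed_tsupport _)

lemma IsTestFun.partialDeriv {U : Set Plane} {ψ : Plane → ℝ} (h : IsTestFun U ψ) (k : Fin 2) :
    IsTestFun U (partialDeriv k ψ) where
  contDiff := by
    have := contDiffOn_partialDeriv isOpen_univ h.contDiff.contDiffOn k
    exact contDiffOn_univ.1 this
  hasCompactSupport := h.hasCompactSupport.of_isClosed_subset (isClosed_tsupport _)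
    (tsupport_partialDeriv_subset k ψ)
  subset := (tsupport_partialDeriv_subset k ψ).trans h.subset

lemma IsTestFun.iterate_partialDeriv {U : Set Plane} {ψ : Plane → ℝ} (h : IsTestFun U ψ)
    (k : Fin 2) (n : ℕ) : IsTestFun U ((_root_.partialDeriv k)^[n] ψ) := by
  induction n with
  | zero => simpa using h
  | succ n ih =>
    simp only [Function.iterate_succ_apply']
    exact ih.partialDeriv k

lemma IsTestFun.multiDeriv {U : Set Plane} {ψ : Plane → ℝ} (h : IsTestFun U ψ) (α : ℕ × ℕ) :
    IsTestFun U (multiDeriv α ψ) :=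
  (h.iterate_partialDeriv 1 α.2).iterate_partialDeriv 0 α.1

lemma IsTestFun.integrable_mul {U : Set Plane} {ψ f : Plane → ℝ} (h : IsTestFun U ψ)
    (hf : LocallyIntegrableOn f U) : Integrable (fun x => f x * ψ x) := by
  have hK : IsCompact (tsupport ψ) := h.hasCompactSupport
  have h1 : IntegrableOn (fun x => f x * ψ x) (tsupport ψ) :=
    (hf.integrableOn_compact_subset h.subset hK).mul_continuousOn
      h.contDiff.continuous.continuousOn hK
  refine (integrableOn_iff_integrable_of_support_subset ?_).1 h1
  exact (Function.support_mul_subset_right f ψ).trans (subset_tsupport ψ)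

lemma IsTestFun.setIntegral_mul {U : Set Plane} {ψ : Plane → ℝ} (h : IsTestFun U ψ)
    (f : Plane → ℝ) : ∫ x in U, f x * ψ x = ∫ x, f x * ψ x :=
  setIntegral_eq_integral_of_forall_compl_eq_zero fun x hx => by
    rw [image_eq_zero_of_notMem_tsupport fun h' => hx (h.subset h'), mul_zero]

lemma IsTestFun.integral_mul_partialDeriv {U : Set Plane} (hU : IsOpen U) {ψ f : Plane → ℝ}
    (h : IsTestFun U ψ) (hf : ContDiffOn ℝ ∞ f U) (k : Fin 2) :
    ∫ x, f x * _root_.partialDeriv k ψ x = - ∫ x, _root_.partialDeriv k f x * ψ x := by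
  have hf' := contDiffOn_partialDeriv hU hf k
  refine integral_mul_fderiv_eq_neg_fderiv_mul_of_integrable
    (h.integrable_mul (hf'.continuousOn.locallyIntegrableOn hU.measurableSet))
    ((h.partialDeriv k).integrable_mul (hf.continuousOn.locallyIntegrableOn hU.measurableSet))
    (h.integrable_mul (hf.continuousOn.locallyIntegrableOn hU.measurableSet))
    (fun x hx => differentiableAt_of_contDiffOn hU hf (h.subset hx))
    (fun x _ => h.contDiff.differentiable (by simp) x)

lemma IsTestFun.integral_mul_iterate_partialDeriv {U : Set Plane} (hU : IsOpen U)
    {ψ f : Plane → ℝ} (h : IsTestFun U ψ) (hf : ContDiffOn ℝ ∞ f U) (k : Fin 2) (n : ℕ) :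
    ∫ x, f x * (_root_.partialDeriv k)^[n] ψ x =
      (-1) ^ n * ∫ x, (_root_.partialDeriv k)^[n] f x * ψ x := by
  induction n generalizing ψ with
  | zero => simp
  | succ n ih =>
    rw [Function.iterate_succ_apply, ih (h.partialDeriv k), Function.iterate_succ_apply',
      h.integral_mul_partialDeriv hU (contDiffOn_iterate_partialDeriv hU hf k n)]
    ring

lemma iterate_partialDeriv_comm {U : Set Plane} (hU : IsOpen U) {f : Plane → ℝ}
    (hf : ContDiffOn ℝ ∞ f U) (j k : Fin 2) (m n : ℕ) :
    EqOn ((partialDeriv j)^[m] ((partialDeriv k)^[n] f))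
      ((partialDeriv k)^[n] ((partialDeriv j)^[m] f)) U := by
  induction m with
  | zero => exact fun x _ => rfl
  | succ m ih =>
    simp only [Function.iterate_succ_apply']
    exact (partialDeriv_eqOn hU ih j).trans
      (partialDeriv_iterate_comm hU (contDiffOn_iterate_partialDeriv hU hf j m) j k n)

/-! ### Weak derivatives -/

/-- Classical derivatives of smooth functions are weak derivatives. -/
lemma isWeakDeriv_of_contDiffOn {U : Set Plane} (hU : IsOpen U) {f : Plane → ℝ}
    (hf : ContDiffOn ℝ ∞ f U) (α : ℕ × ℕ) : IsWeakDeriv U α f (multiDeriv α f) := by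
  refine ⟨hf.continuousOn.locallyIntegrableOn hU.measurableSet,
    (contDiffOn_multiDeriv hU hf α).continuousOn.locallyIntegrableOn hU.measurableSet, ?_⟩
  intro ψ h1 h2 h3
  have h : IsTestFun U ψ := ⟨h1, h2, h3⟩
  rw [(h.multiDeriv α).setIntegral_mul, h.setIntegral_mul]
  -- Integration by parts releases the outermost derivatives of `ψ` first, so they land on `f` in
  -- the reverse order.
  have e : ∫ x, multiDeriv α f x * ψ x =
      ∫ x, (partialDeriv 1)^[α.2] ((partialDeriv 0)^[α.1] f) x * ψ x := by
    refine integral_congr_ae (Filter.Eventually.of_forall fun x => ?_)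
    by_cases hx : x ∈ U
    · simp only [multiDeriv, iterate_partialDeriv_comm hU hf 0 1 α.1 α.2 hx]
    · simp only [image_eq_zero_of_notMem_tsupport fun h' => hx (h.subset h'), mul_zero]
  rw [e, multiDeriv,
    (h.iterate_partialDeriv 1 α.2).integral_mul_iterate_partialDeriv hU hf,
    h.integral_mul_iterate_partialDeriv hU (contDiffOn_iterate_partialDeriv hU hf 0 α.1)]
  ring

/-- Fundamental lemma of the calculus of variations. It is what allows the infimum in
`sobolevSemiSq` to be evaluated at any given family of weak derivatives. -/
lemma IsWeakDeriv.ae_eq {U : Set Plane} (hU : IsOpen U) {α : ℕ × ℕ} {f g g' : Plane → ℝ}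
    (h : IsWeakDeriv U α f g) (h' : IsWeakDeriv U α f g') : g =ᵐ[volume.restrict U] g' := by
  have key : ∀ᵐ x, x ∈ U → (g - g') x = 0 := by
    refine hU.ae_eq_zero_of_integral_contDiff_smul_eq_zero (h.2.1.sub h'.2.1) ?_
    intro ψ h1 h2 h3
    have ht : IsTestFun U ψ := ⟨h1, h2, h3⟩
    have e1 := h.2.2 ψ h1 h2 h3
    rw [h'.2.2 ψ h1 h2 h3] at e1
    have e2 := mul_left_cancel₀ (pow_ne_zero _ (by norm_num)) e1
    rw [ht.setIntegral_mul, ht.setIntegral_mul] at e2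
    have : ∀ x, ψ x • (g - g') x = g x * ψ x - g' x * ψ x := fun x => by
      simp only [Pi.sub_apply, smul_eq_mul]; ring
    simp only [this]
    rw [integral_sub (ht.integrable_mul h.2.1) (ht.integrable_mul h'.2.1), e2, sub_self]
  rw [Filter.EventuallyEq, ae_restrict_iff' hU.measurableSet]
  filter_upwards [key] with x hx hxU
  exact sub_eq_zero.1 (hx hxU)

lemma IsWeakDeriv.add {U : Set Plane} {α : ℕ × ℕ} {f g f' g' : Plane → ℝ}
    (h : IsWeakDeriv U α f g) (h' : IsWeakDeriv U α f' g') :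
    IsWeakDeriv U α (fun x => f x + f' x) (fun x => g x + g' x) := by
  refine ⟨h.1.add h'.1, h.2.1.add h'.2.1, fun ψ h1 h2 h3 => ?_⟩
  have ht : IsTestFun U ψ := ⟨h1, h2, h3⟩
  simp only [add_mul]
  rw [integral_add ((ht.multiDeriv α).integrable_mul h.1).integrableOn
    ((ht.multiDeriv α).integrable_mul h'.1).integrableOn,
    integral_add (ht.integrable_mul h.2.1).integrableOn (ht.integrable_mul h'.2.1).integrableOn,
    h.2.2 ψ h1 h2 h3, h'.2.2 ψ h1 h2 h3]
  ring

lemma IsWeakDeriv.const_mul {U : Set Plane} {α : ℕ × ℕ} {f g : Plane → ℝ}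
    (h : IsWeakDeriv U α f g) (c : ℝ) :
    IsWeakDeriv U α (fun x => c * f x) (fun x => c * g x) := by
  refine ⟨h.1.smul c, h.2.1.smul c, fun ψ h1 h2 h3 => ?_⟩
  simp only [mul_assoc, integral_const_mul, h.2.2 ψ h1 h2 h3]
  ring

/-! ### The Sobolev seminorm -/

lemma sobolevSemiSq_le {r : ℕ} {U : Set Plane} {f : Plane → ℝ} {g : ℕ × ℕ → Plane → ℝ}
    (h : ∀ α ∈ Finset.HasAntidiagonal.antidiagonal r, IsWeakDeriv U α f (g α)) :
    sobolevSemiSq r U f ≤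
      ∑ α ∈ Finset.HasAntidiagonal.antidiagonal r, ∫⁻ x in U, ‖g α x‖ₑ ^ 2 :=
  iInf₂_le g h

lemma sobolevSemiSq_eq {r : ℕ} {U : Set Plane} (hU : IsOpen U) {f : Plane → ℝ}
    {g : ℕ × ℕ → Plane → ℝ}
    (h : ∀ α ∈ Finset.HasAntidiagonal.antidiagonal r, IsWeakDeriv U α f (g α)) :
    sobolevSemiSq r U f =
      ∑ α ∈ Finset.HasAntidiagonal.antidiagonal r, ∫⁻ x in U, ‖g α x‖ₑ ^ 2 := by
  refine le_antisymm (sobolevSemiSq_le h) (le_iInf₂ fun g' h' => le_of_eq ?_)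
  refine Finset.sum_congr rfl fun α hα => lintegral_congr_ae ?_
  filter_upwards [(h α hα).ae_eq hU (h' α hα)] with x hx
  rw [hx]

lemma sobolevSemiSq_of_contDiffOn {U : Set Plane} (hU : IsOpen U) {f : Plane → ℝ}
    (hf : ContDiffOn ℝ ∞ f U) (r : ℕ) :
    sobolevSemiSq r U f =
      ∑ α ∈ Finset.HasAntidiagonal.antidiagonal r, ∫⁻ x in U, ‖multiDeriv α f x‖ₑ ^ 2 :=
  sobolevSemiSq_eq hU fun α _ => isWeakDeriv_of_contDiffOn hU hf α

lemma sobolevSemiSq_const_mul_le (r : ℕ) (U : Set Plane) (f : Plane → ℝ) {c : ℝ} (hc : c ≠ 0) :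
    sobolevSemiSq r U (fun x => c * f x) ≤ ‖c‖ₑ ^ 2 * sobolevSemiSq r U f := by
  have h0 : ‖c‖ₑ ^ 2 ≠ 0 := pow_ne_zero _ (enorm_ne_zero.2 hc)
  have h1 : ‖c‖ₑ ^ 2 ≠ ⊤ := ENNReal.pow_ne_top enorm_ne_top
  -- The infimum may be over an empty family; a nonzero finite factor still passes through it.
  rw [sobolevSemiSq, sobolevSemiSq, ENNReal.mul_iInf_of_ne h0 h1]
  refine le_iInf fun g => ?_
  rw [ENNReal.mul_iInf_of_ne h0 h1]
  refine le_iInf fun hg => (iInf₂_le (fun α x => c * g α x)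
    fun α hα => (hg α hα).const_mul c).trans (le_of_eq ?_)
  rw [Finset.mul_sum]
  refine Finset.sum_congr rfl fun α _ => ?_
  simp only [enorm_mul, mul_pow]
  exact lintegral_const_mul' _ _ h1

/-! ### Seminorm inequalities -/

/-- Minkowski's inequality in `ℓ²`, applied to the square roots. -/
lemma rpow_half_sum_le {ι : Type*} (s : Finset ι) (a b c : ι → ℝ≥0∞)
    (h : ∀ i ∈ s, c i ^ (1 / 2 : ℝ) ≤ a i ^ (1 / 2 : ℝ) + b i ^ (1 / 2 : ℝ)) :
    (∑ i ∈ s, c i) ^ (1 / 2 : ℝ) ≤ (∑ i ∈ s, a i) ^ (1 / 2 : ℝ) + (∑ i ∈ s, b i) ^ (1 / 2 : ℝ) := by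
  have key := ENNReal.Lp_add_le s (fun i => a i ^ (1 / 2 : ℝ)) (fun i => b i ^ (1 / 2 : ℝ))
    (p := 2) (by norm_num)
  have e : ∀ x : ℝ≥0∞, (x ^ (1 / 2 : ℝ)) ^ (2 : ℝ) = x := fun x => by
    rw [← ENNReal.rpow_mul]; norm_num
  simp only [e] at key
  refine le_trans (ENNReal.rpow_le_rpow (Finset.sum_le_sum fun i hi => ?_) (by norm_num)) key
  calc c i = (c i ^ (1 / 2 : ℝ)) ^ (2 : ℝ) := (e _).symm
    _ ≤ _ := ENNReal.rpow_le_rpow (h i hi) (by norm_num)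

lemma lintegral_sq_rpow_half {μ : Measure Plane} (g : Plane → ℝ) :
    (∫⁻ x, ‖g x‖ₑ ^ 2 ∂μ) ^ (1 / 2 : ℝ) = eLpNorm g 2 μ := by
  rw [eLpNorm_eq_lintegral_rpow_enorm_toReal (by norm_num) (by norm_num)]
  simp

lemma eLpNorm_two_sq {μ : Measure Plane} (g : Plane → ℝ) :
    eLpNorm g 2 μ ^ 2 = ∫⁻ x, ‖g x‖ₑ ^ 2 ∂μ := by
  rw [← lintegral_sq_rpow_half, ← ENNReal.rpow_natCast, ← ENNReal.rpow_mul]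
  norm_num

lemma rpow_half_iInf {ι : Sort*} (a : ι → ℝ≥0∞) :
    (⨅ i, a i) ^ (1 / 2 : ℝ) = ⨅ i, a i ^ (1 / 2 : ℝ) :=
  (ENNReal.orderIsoRpow (1 / 2 : ℝ) (by norm_num)).map_iInf a

/-- Minkowski twice: in `L²` for each multi-index, then in `ℓ²` over the multi-indices. The square
root, being an order isomorphism, commutes with the infimum. -/
lemma sobolevSemiSq_add_le (r : ℕ) (U : Set Plane) (f f' : Plane → ℝ) :
    sobolevSemiSq r U (fun x => f x + f' x) ^ (1 / 2 : ℝ) ≤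
      sobolevSemiSq r U f ^ (1 / 2 : ℝ) + sobolevSemiSq r U f' ^ (1 / 2 : ℝ) := by
  have e : ∀ f, sobolevSemiSq r U f ^ (1 / 2 : ℝ) = ⨅ (g : ℕ × ℕ → Plane → ℝ)
      (_ : ∀ α ∈ Finset.HasAntidiagonal.antidiagonal r, IsWeakDeriv U α f (g α)),
      (∑ α ∈ Finset.HasAntidiagonal.antidiagonal r, ∫⁻ x in U, ‖g α x‖ₑ ^ 2) ^ (1 / 2 : ℝ) :=
    fun f => by simp only [sobolevSemiSq, rpow_half_iInf]
  rw [e f, e f']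
  refine ENNReal.le_iInf₂_add_iInf₂ fun g hg g' hg' => ?_
  refine (ENNReal.rpow_le_rpow (sobolevSemiSq_le
    fun α hα => (hg α hα).add (hg' α hα)) (by norm_num)).trans ?_
  refine rpow_half_sum_le _ _ _ _ fun α hα => ?_
  simp only [lintegral_sq_rpow_half]
  exact eLpNorm_add_le (hg α hα).2.1.aestronglyMeasurable (hg' α hα).2.1.aestronglyMeasurable
    (by norm_num)

/-- The combined seminorm of a finite family of orders and sets. -/
def familySemi {ι : Type*} (s : Finset ι) (r : ι → ℕ) (U : ι → Set Plane) (f : Plane → ℝ) :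
    ℝ≥0∞ := (∑ i ∈ s, sobolevSemiSq (r i) (U i) f) ^ (1 / 2 : ℝ)

lemma familySemi_add_le {ι : Type*} (s : Finset ι) (r : ι → ℕ) (U : ι → Set Plane)
    (f f' : Plane → ℝ) :
    familySemi s r U (fun x => f x + f' x) ≤ familySemi s r U f + familySemi s r U f' :=
  rpow_half_sum_le _ _ _ _ fun _ _ => sobolevSemiSq_add_le _ _ _ _

lemma familySemi_const_mul_le {ι : Type*} (s : Finset ι) (r : ι → ℕ) (U : ι → Set Plane)
    (f : Plane → ℝ) {c : ℝ} (hc : c ≠ 0) :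
    familySemi s r U (fun x => c * f x) ≤ ‖c‖ₑ * familySemi s r U f := by
  have : ‖c‖ₑ = (‖c‖ₑ ^ 2) ^ (1 / 2 : ℝ) := by
    rw [← ENNReal.rpow_natCast, ← ENNReal.rpow_mul]; norm_num
  rw [familySemi, familySemi, this, ← ENNReal.mul_rpow_of_nonneg _ _ (by norm_num), Finset.mul_sum]
  exact ENNReal.rpow_le_rpow (Finset.sum_le_sum fun i _ =>
    sobolevSemiSq_const_mul_le _ _ _ hc) (by norm_num)

/-- Broken seminorms vary the set and Sobolev norms vary the order; as instances of `familySemi`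
they share one proof of subadditivity and homogeneity. -/
lemma brokenSemi_eq_familySemi {ι : Type} [Fintype ι] (r : ℕ) (M : ι → MeshElement)
    (f : Plane → ℝ) :
    brokenSemi r M f = familySemi Finset.univ (fun _ => r) (fun e => (M e).dom) f := rfl

lemma sobolevNorm_eq_familySemi (k : ℕ) (U : Set Plane) (f : Plane → ℝ) :
    sobolevNorm k U f = familySemi (Finset.range (k + 1)) id (fun _ => U) f := rfl

/-! ### Polynomials -/

lemma contDiff_polyFun (P : Poly2) : ContDiff ℝ ∞ (polyFun P) := by
  induction P using MvPolynomial.induction_on with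
  | C a =>
    have : polyFun (MvPolynomial.C a) = fun _ => a := by ext x; simp [polyFun]
    rw [this]; exact contDiff_const
  | add P Q hP hQ =>
    have : polyFun (P + Q) = fun x => polyFun P x + polyFun Q x := by
      ext x; simp [polyFun]
    rw [this]; exact hP.add hQ
  | mul_X P i hP =>
    have : polyFun (P * MvPolynomial.X i) = fun x => polyFun P x * x i := by
      ext x; simp [polyFun]
    rw [this]; exact ContDiff.mul hP (contDiff_apply ℝ ℝ i)

lemma polyFun_add (P Q : Poly2) : polyFun (P + Q) = fun x => polyFun P x + polyFun Q x := by
  ext x; simp [polyFun]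

lemma polyFun_smul (c : ℝ) (P : Poly2) : polyFun (c • P) = fun x => c * polyFun P x := by
  ext x; simp [polyFun]

lemma hasFDerivAt_polyFun (P : Poly2) (x : Plane) :
    HasFDerivAt (polyFun P)
      (∑ k, polyFun (MvPolynomial.pderiv k P) x •
        (ContinuousLinearMap.proj k : Plane →L[ℝ] ℝ)) x := by
  induction P using MvPolynomial.induction_on with
  | C a =>
    have : polyFun (MvPolynomial.C a) = fun _ => a := by ext x; simp [polyFun]
    rw [this]
    simpa [polyFun] using hasFDerivAt_const a x
  | add P Q hP hQ =>
    rw [polyFun_add]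
    refine (hP.add hQ).congr_fderiv ?_
    simp only [map_add, polyFun_add, add_smul, Finset.sum_add_distrib]
  | mul_X P i hP =>
    have : polyFun (P * MvPolynomial.X i) = fun x => polyFun P x * x i := by
      ext x; simp [polyFun]
    rw [this]
    refine (hP.mul (hasFDerivAt_apply i x)).congr_fderiv ?_
    ext v
    have h : ∀ k, polyFun (MvPolynomial.pderiv k (P * MvPolynomial.X i)) x =
        polyFun P x * (Pi.single k 1 : Plane) i + x i * polyFun (MvPolynomial.pderiv k P) x := by
      intro k
      simp only [polyFun, Derivation.leibniz, MvPolynomial.pderiv_X, smul_eq_mul, map_add,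
        map_mul, MvPolynomial.eval_X]
      congr 2
      by_cases hk : k = i
      · subst hk; simp
      · simp [Ne.symm hk]
    simp only [h]
    fin_cases i <;> simp [Fin.sum_univ_two] <;> ring

lemma partialDeriv_polyFun (P : Poly2) (k : Fin 2) :
    partialDeriv k (polyFun P) = polyFun (MvPolynomial.pderiv k P) := by
  ext x
  rw [partialDeriv, (hasFDerivAt_polyFun P x).fderiv]
  fin_cases k <;> simp [Fin.sum_univ_two]

lemma iterate_partialDeriv_polyFun (P : Poly2) (k : Fin 2) (n : ℕ) :
    (partialDeriv k)^[n] (polyFun P) = polyFun ((MvPolynomial.pderiv k)^[n] P) := by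
  induction n with
  | zero => rfl
  | succ n ih => rw [Function.iterate_succ_apply', Function.iterate_succ_apply', ih,
      partialDeriv_polyFun]

lemma multiDeriv_polyFun (P : Poly2) (α : ℕ × ℕ) :
    multiDeriv α (polyFun P) =
      polyFun ((MvPolynomial.pderiv 0)^[α.1] ((MvPolynomial.pderiv 1)^[α.2] P)) := by
  rw [multiDeriv, iterate_partialDeriv_polyFun, iterate_partialDeriv_polyFun]

lemma exists_bound_polyFun (P : Poly2) {U : Set Plane} (hb : Bornology.IsBounded U) :
    ∃ C : ℝ, 0 ≤ C ∧ ∀ x ∈ U, ‖polyFun P x‖ ≤ C := by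
  obtain ⟨C, hC⟩ := (hb.isCompact_closure).exists_bound_of_continuousOn
    (contDiff_polyFun P).continuous.continuousOn
  exact ⟨max C 0, le_max_right _ _, fun x hx => (hC x (subset_closure hx)).trans (le_max_left _ _)⟩

lemma memLp_polyFun (P : Poly2) {U : Set Plane} (hm : MeasurableSet U)
    (hb : Bornology.IsBounded U) : MemLp (polyFun P) 2 (volume.restrict U) := by
  obtain ⟨C, _, hC⟩ := exists_bound_polyFun P hb
  have : IsFiniteMeasure (volume.restrict U) := ⟨by
    simpa using hb.measure_lt_top⟩
  exact MemLp.of_bound (contDiff_polyFun P).continuous.aestronglyMeasurable C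
    ((ae_restrict_iff' hm).2 (Filter.Eventually.of_forall hC))

lemma sobolevSemiSq_polyFun_lt_top (P : Poly2) {U : Set Plane} (hU : IsOpen U)
    (hb : Bornology.IsBounded U) (r : ℕ) : sobolevSemiSq r U (polyFun P) < ⊤ := by
  rw [sobolevSemiSq_of_contDiffOn hU (contDiff_polyFun P).contDiffOn]
  refine ENNReal.sum_lt_top.2 fun α _ => ?_
  rw [multiDeriv_polyFun, ← eLpNorm_two_sq]
  exact ENNReal.pow_lt_top (memLp_polyFun _ hU.measurableSet hb).2

/-- A ball in the sup norm is a product of infinite sets, and such a product determines a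
polynomial. -/
lemma polyFun_eq_zero_of_isOpen {P : Poly2} {U : Set Plane} (hU : IsOpen U) (hne : U.Nonempty)
    (h : ∀ x ∈ U, polyFun P x = 0) : P = 0 := by
  obtain ⟨x, hx⟩ := hne
  obtain ⟨ε, hε, hball⟩ := Metric.isOpen_iff.1 hU x hx
  refine MvPolynomial.funext_set (fun i => Metric.ball (x i) ε) (fun i => ?_) (fun y hy => ?_)
  · rw [Real.ball_eq_Ioo]; exact Set.Ioo_infinite (by linarith)
  · rw [map_zero]
    refine h y (hball ?_)
    rw [Metric.mem_ball, dist_pi_lt_iff hε]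
    exact fun i => hy i (Set.mem_univ i)

/-- The order-0 term suffices: a continuous function that vanishes almost everywhere on an open set
vanishes there identically. -/
lemma sobolevNorm_polyFun_ne_zero {P : Poly2} (hP : P ≠ 0) {U : Set Plane} (hU : IsOpen U)
    (hne : U.Nonempty) (k : ℕ) : sobolevNorm k U (polyFun P) ≠ 0 := by
  intro h
  rw [sobolevNorm, ENNReal.rpow_eq_zero_iff_of_pos (by norm_num)] at h
  have h0 := (Finset.sum_eq_zero_iff.1 h) 0 (by simp)
  rw [sobolevSemiSq_of_contDiffOn hU (contDiff_polyFun P).contDiffOn] at h0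
  have h1 : ∫⁻ x in U, ‖polyFun P x‖ₑ ^ 2 = 0 := by simpa [multiDeriv] using h0
  rw [lintegral_eq_zero_iff (by
    exact ((contDiff_polyFun P).continuous.enorm.measurable.pow_const 2))] at h1
  apply hP
  refine polyFun_eq_zero_of_isOpen hU hne fun x hx => ?_
  have h2 : polyFun P =ᵐ[volume.restrict U] fun _ => (0 : ℝ) := by
    filter_upwards [h1] with y hy
    simpa using hy
  exact Measure.eqOn_open_of_ae_eq h2 hU (contDiff_polyFun P).continuous.continuousOn
    continuousOn_const hx

/-! ### Best approximation errors -/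

/-- The local spaces of the mesh are vector spaces. -/
def IsLinearMesh {ι : Type} (M : ι → MeshElement) : Prop :=
  ∀ e, ∃ S : Submodule ℝ (Plane → ℝ), (M e).space = S

lemma meshSpace_add {ι : Type} {M : ι → MeshElement} (hM : IsLinearMesh M) {f g : Plane → ℝ}
    (hf : f ∈ meshSpace M) (hg : g ∈ meshSpace M) : (fun x => f x + g x) ∈ meshSpace M := by
  refine ⟨hf.1.add hg.1, fun e => ?_⟩
  obtain ⟨S, hS⟩ := hM e
  have h1 := hf.2 e
  have h2 := hg.2 e
  rw [hS] at h1 h2 ⊢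
  exact S.add_mem h1 h2

lemma meshSpace_const_mul {ι : Type} {M : ι → MeshElement} (hM : IsLinearMesh M)
    {f : Plane → ℝ} (hf : f ∈ meshSpace M) (c : ℝ) : (fun x => c * f x) ∈ meshSpace M := by
  refine ⟨hf.1.const_mul c, fun e => ?_⟩
  obtain ⟨S, hS⟩ := hM e
  have h1 := hf.2 e
  rw [hS] at h1 ⊢
  exact S.smul_mem c h1

lemma zero_mem_meshSpace {ι : Type} {M : ι → MeshElement} (hM : IsLinearMesh M) :
    (fun _ => (0 : ℝ)) ∈ meshSpace M := by
  refine ⟨MemLp.zero', fun e => ?_⟩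
  obtain ⟨S, hS⟩ := hM e
  rw [hS]
  exact S.zero_mem

lemma bestError_le_brokenSemi {ι : Type} [Fintype ι] {M : ι → MeshElement} (hM : IsLinearMesh M)
    (r : ℕ) (f : Plane → ℝ) : bestError r M f ≤ brokenSemi r M f :=
  (iInf₂_le _ (zero_mem_meshSpace hM)).trans (by simp)

lemma bestError_add_le {ι : Type} [Fintype ι] {M : ι → MeshElement} (hM : IsLinearMesh M)
    (r : ℕ) (f g : Plane → ℝ) :
    bestError r M (fun x => f x + g x) ≤ bestError r M f + bestError r M g := by
  refine ENNReal.le_iInf₂_add_iInf₂ fun fh hf gh hg => ?_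
  refine (iInf₂_le _ (meshSpace_add hM hf hg)).trans ?_
  refine le_trans (le_of_eq ?_) (familySemi_add_le _ _ _ _ _)
  rw [brokenSemi_eq_familySemi]
  congr 1; ext x; ring

lemma bestError_const_mul_le {ι : Type} [Fintype ι] {M : ι → MeshElement} (hM : IsLinearMesh M)
    (r : ℕ) (f : Plane → ℝ) {c : ℝ} (hc : c ≠ 0) :
    bestError r M (fun x => c * f x) ≤ ‖c‖ₑ * bestError r M f := by
  rw [bestError, bestError, ENNReal.mul_iInf_of_ne (enorm_ne_zero.2 hc) enorm_ne_top]
  refine le_iInf fun fh => ?_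
  rw [ENNReal.mul_iInf_of_ne (enorm_ne_zero.2 hc) enorm_ne_top]
  refine le_iInf fun hf => (iInf₂_le _ (meshSpace_const_mul hM hf c)).trans ?_
  refine le_trans (le_of_eq ?_) (familySemi_const_mul_le _ _ _ _ hc)
  rw [brokenSemi_eq_familySemi]
  congr 1; ext x; ring

lemma brokenSemi_polyFun_lt_top {ι : Type} [Fintype ι] {M : ι → MeshElement} (P : Poly2)
    (hU : ∀ e, IsOpen (M e).dom) (hb : ∀ e, Bornology.IsBounded (M e).dom) (r : ℕ) :
    brokenSemi r M (polyFun P) < ⊤ :=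
  ENNReal.rpow_lt_top_of_nonneg (by norm_num) (ENNReal.sum_lt_top.2 fun e _ =>
    sobolevSemiSq_polyFun_lt_top P (hU e) (hb e) r).ne

lemma sobolevNorm_polyFun_lt_top (P : Poly2) {U : Set Plane} (hU : IsOpen U)
    (hb : Bornology.IsBounded U) (k : ℕ) : sobolevNorm k U (polyFun P) < ⊤ :=
  ENNReal.rpow_lt_top_of_nonneg (by norm_num) (ENNReal.sum_lt_top.2 fun _ _ =>
    sobolevSemiSq_polyFun_lt_top P hU hb _).ne

/-! ### Geometry of the parameterizations -/

lemma isOpen_dyadicSquare (k j₁ j₂ : ℕ) : IsOpen (dyadicSquare k j₁ j₂) := by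
  have h : dyadicSquare k j₁ j₂ = {u | (j₁ : ℝ) / 2 ^ k < u 0} ∩ ({u | u 0 < ((j₁ : ℝ) + 1) / 2 ^ k} ∩
      ({u | (j₂ : ℝ) / 2 ^ k < u 1} ∩ {u | u 1 < ((j₂ : ℝ) + 1) / 2 ^ k})) := rfl
  rw [h]
  refine (isOpen_lt continuous_const (continuous_apply 0)).inter
    ((isOpen_lt (continuous_apply 0) continuous_const).inter
    ((isOpen_lt continuous_const (continuous_apply 1)).inter
    (isOpen_lt (continuous_apply 1) continuous_const)))

lemma dyadicSquare_zero : dyadicSquare 0 0 0 = unitSquare := by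
  ext u; simp [dyadicSquare, unitSquare]

lemma isOpen_unitSquare : IsOpen unitSquare := dyadicSquare_zero ▸ isOpen_dyadicSquare 0 0 0

lemma dyadicSquare_subset {k j₁ j₂ : ℕ} (h₁ : j₁ < 2 ^ k) (h₂ : j₂ < 2 ^ k) :
    dyadicSquare k j₁ j₂ ⊆ unitSquare := by
  intro u ⟨h1, h2, h3, h4⟩
  have hb : ∀ j : ℕ, j < 2 ^ k → 0 ≤ (j : ℝ) / 2 ^ k ∧ ((j : ℝ) + 1) / 2 ^ k ≤ 1 := fun j hj => by
    refine ⟨by positivity, ?_⟩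
    rw [div_le_one (by positivity)]
    exact_mod_cast hj
  exact ⟨(hb j₁ h₁).1.trans_lt h1, h2.trans_le (hb j₁ h₁).2, (hb j₂ h₂).1.trans_lt h3,
    h4.trans_le (hb j₂ h₂).2⟩

lemma isBounded_unitSquare : Bornology.IsBounded unitSquare := by
  refine (Metric.isBounded_closedBall (x := (0 : Plane)) (r := 1)).subset fun u hu => ?_
  rw [mem_closedBall_zero_iff, pi_norm_le_iff_of_nonneg zero_le_one]
  obtain ⟨h1, h2, h3, h4⟩ := hu
  intro i
  fin_cases i
  · exact abs_le.2 ⟨by simp only [Fin.zero_eta]; linarith, h2.le⟩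
  · exact abs_le.2 ⟨by simp only [Fin.mk_one]; linarith, h4.le⟩

lemma unitSquare_nonempty : unitSquare.Nonempty :=
  ⟨fun _ => 1 / 2, by norm_num [unitSquare]⟩

/-- The Jacobian matrix of a polynomial map. -/
def jacobianMatrix (G : Fin 2 → Poly2) (u : Plane) : Matrix (Fin 2) (Fin 2) ℝ :=
  Matrix.of fun a b => MvPolynomial.eval u (MvPolynomial.pderiv b (G a))

/-- The derivative of a polynomial map. -/
def polyMapDeriv (G : Fin 2 → Poly2) (u : Plane) : Plane →L[ℝ] Plane :=
  LinearMap.toContinuousLinearMap (Matrix.toLin' (jacobianMatrix G u))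

lemma det_polyMapDeriv (G : Fin 2 → Poly2) (u : Plane) :
    (polyMapDeriv G u).det = (jacobianMatrix G u).det := by
  simp [polyMapDeriv, ContinuousLinearMap.det]

lemma contDiff_polyMap (G : Fin 2 → Poly2) : ContDiff ℝ ∞ (polyMap G) :=
  contDiff_pi.2 fun a => contDiff_polyFun (G a)

lemma hasFDerivAt_polyMap (G : Fin 2 → Poly2) (u : Plane) :
    HasFDerivAt (polyMap G) (polyMapDeriv G u) u := by
  refine hasFDerivAt_pi'.2 fun a => ?_
  refine (hasFDerivAt_polyFun (G a) u).congr_fderiv ?_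
  ext v
  fin_cases a <;> simp [polyMapDeriv, jacobianMatrix, polyFun]

/-- The derivative of a polynomial map as an isomorphism. -/
def polyMapDerivEquiv (G : Fin 2 → Poly2) (u : Plane) (h : (jacobianMatrix G u).det ≠ 0) :
    Plane ≃L[ℝ] Plane :=
  ContinuousLinearMap.toContinuousLinearEquivOfDetNeZero (polyMapDeriv G u)
    (by rwa [det_polyMapDeriv])

lemma hasFDerivAt_polyMap_equiv (G : Fin 2 → Poly2) (u : Plane)
    (h : (jacobianMatrix G u).det ≠ 0) :
    HasFDerivAt (polyMap G) (polyMapDerivEquiv G u h : Plane →L[ℝ] Plane) u := by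
  refine (hasFDerivAt_polyMap G u).congr_fderiv ?_
  ext v : 1
  simp [polyMapDerivEquiv]

/-- Inverse function theorem: an invertible derivative makes the map send neighbourhoods to
neighbourhoods, with no need of injectivity. -/
lemma isOpen_image_polyMap {G : Fin 2 → Poly2} {b : Set Plane} (hb : IsOpen b)
    (h : ∀ u ∈ b, (jacobianMatrix G u).det ≠ 0) : IsOpen (polyMap G '' b) := by
  rw [isOpen_iff_mem_nhds]
  rintro _ ⟨u, hu, rfl⟩
  have hs : HasStrictFDerivAt (polyMap G) (polyMapDerivEquiv G u (h u hu) : Plane →L[ℝ] Plane) u :=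
    (contDiff_polyMap G).contDiffAt.hasStrictFDerivAt' (hasFDerivAt_polyMap_equiv G u (h u hu))
      (by simp)
  rw [← hs.map_nhds_eq_of_equiv]
  exact image_mem_map (hb.mem_nhds hu)

/-- A function that is smooth in the coordinates of an injective regular parameterization is
smooth. -/
lemma contDiffOn_of_comp_polyMap {G : Fin 2 → Poly2} {b : Set Plane} (hb : IsOpen b)
    (h : ∀ u ∈ b, (jacobianMatrix G u).det ≠ 0)
    {f R : Plane → ℝ} (hR : ContDiff ℝ ∞ R) (hf : ∀ u ∈ b, f (polyMap G u) = R u) :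
    ContDiffOn ℝ ∞ f (polyMap G '' b) := by
  rintro _ ⟨u, hu, rfl⟩
  refine ContDiffAt.contDiffWithinAt ?_
  have hG : ContDiffAt ℝ ∞ (polyMap G) u := (contDiff_polyMap G).contDiffAt
  have hd := hasFDerivAt_polyMap_equiv G u (h u hu)
  have hs := hG.hasStrictFDerivAt' hd (by simp)
  have hinv := hG.to_localInverse hd (by simp)
  have h1 : ContDiffAt ℝ ∞ (fun y => R (hs.localInverse _ _ _ y)) (polyMap G u) :=
    hR.contDiffAt.comp _ hinv
  -- Near the image point `f` equals `R` composed with the smooth local inverse.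
  refine h1.congr_of_eventuallyEq ?_
  have e1 : ∀ᶠ y in 𝓝 (polyMap G u), polyMap G (hs.localInverse _ _ _ y) = y :=
    hs.eventually_right_inverse
  have e2 : ∀ᶠ y in 𝓝 (polyMap G u), hs.localInverse _ _ _ y ∈ b := by
    have := hs.localInverse_continuousAt
    rw [ContinuousAt, hs.localInverse_apply_image] at this
    exact this (hb.mem_nhds hu)
  filter_upwards [e1, e2] with y h1 h2
  rw [← hf _ h2, h1]

/-! ### Dilations -/

lemma isOpen_image_smul {c : ℝ} (hc : c ≠ 0) {U : Set Plane} (hU : IsOpen U) :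
    IsOpen ((fun x : Plane => c • x) '' U) := by
  have := (Homeomorph.smulOfNeZero c hc (α := Plane)).isOpenMap U hU
  exact this

lemma lintegral_image_affine (a : Plane) {c : ℝ} (hc : 0 < c) {U : Set Plane}
    (hU : MeasurableSet U) (F : Plane → ℝ≥0∞) :
    ∫⁻ x in (fun x : Plane => a + c • x) '' U, F x =
      ENNReal.ofReal c ^ 2 * ∫⁻ x in U, F (a + c • x) := by
  have hd : ∀ x ∈ U, HasFDerivWithinAt (fun x : Plane => a + c • x)
      (c • ContinuousLinearMap.id ℝ Plane) U x := fun x _ =>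
    (((hasFDerivAt_id x).const_smul c).const_add a).hasFDerivWithinAt
  rw [lintegral_image_eq_lintegral_abs_det_fderiv_mul volume hU hd]
  · have : (c • ContinuousLinearMap.id ℝ Plane).det = c ^ 2 := by
      simp [ContinuousLinearMap.det]
    rw [this, abs_of_pos (by positivity), lintegral_const_mul' _ _ ENNReal.ofReal_ne_top,
      ENNReal.ofReal_pow hc.le]
  · intro x _ y _ h
    exact smul_right_injective Plane hc.ne' (add_left_cancel h)

lemma lintegral_image_smul {c : ℝ} (hc : 0 < c) {U : Set Plane}
    (hU : MeasurableSet U) (F : Plane → ℝ≥0∞) :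
    ∫⁻ x in (fun x : Plane => c • x) '' U, F x =
      ENNReal.ofReal c ^ 2 * ∫⁻ x in U, F (c • x) := by
  simpa using lintegral_image_affine 0 hc hU F

lemma partialDeriv_comp_smul (c : ℝ) (k : Fin 2) (f : Plane → ℝ) :
    partialDeriv k (fun x => f (c • x)) = fun x => c * partialDeriv k f (c • x) := by
  ext x
  simp only [partialDeriv]
  rw [fderiv_comp_smul]
  simp

lemma partialDeriv_const_mul (c : ℝ) (k : Fin 2) (f : Plane → ℝ) :
    partialDeriv k (fun x => c * f x) = fun x => c * partialDeriv k f x := by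
  ext x
  have : (fun x => c * f x) = c • f := rfl
  simp only [partialDeriv]
  rw [this, fderiv_const_smul_field]
  simp

lemma iterate_partialDeriv_comp_smul (c : ℝ) (k : Fin 2) (f : Plane → ℝ) (n : ℕ) :
    (partialDeriv k)^[n] (fun x => f (c • x)) =
      fun x => c ^ n * (partialDeriv k)^[n] f (c • x) := by
  induction n with
  | zero => simp
  | succ n ih =>
    simp only [Function.iterate_succ_apply', ih, partialDeriv_const_mul]
    rw [partialDeriv_comp_smul c k ((partialDeriv k)^[n] f)]
    ext x; ring

lemma iterate_partialDeriv_const_mul (c : ℝ) (k : Fin 2) (f : Plane → ℝ) (n : ℕ) :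
    (partialDeriv k)^[n] (fun x => c * f x) = fun x => c * (partialDeriv k)^[n] f x := by
  induction n with
  | zero => rfl
  | succ n ih => simp only [Function.iterate_succ_apply', ih, partialDeriv_const_mul]

lemma multiDeriv_comp_smul (c : ℝ) (α : ℕ × ℕ) (f : Plane → ℝ) :
    multiDeriv α (fun x => f (c • x)) = fun x => c ^ (α.1 + α.2) * multiDeriv α f (c • x) := by
  rw [multiDeriv, iterate_partialDeriv_comp_smul, iterate_partialDeriv_const_mul,
    iterate_partialDeriv_comp_smul]
  ext x
  rw [multiDeriv]; ring

lemma locallyIntegrableOn_comp_smul {c : ℝ} (hc : 0 < c) {U : Set Plane} (hU : IsOpen U)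
    {f : Plane → ℝ} (hf : LocallyIntegrableOn f ((fun x : Plane => c • x) '' U)) :
    LocallyIntegrableOn (fun x => f (c • x)) U := by
  rw [locallyIntegrableOn_iff hU.isLocallyClosed]
  intro K hKU hK
  have h1 : IntegrableOn f ((fun x : Plane => c • x) '' K) :=
    hf.integrableOn_compact_subset (image_mono hKU) (hK.image (continuous_const_smul c))
  have hd : ∀ x ∈ K, HasFDerivWithinAt (fun x : Plane => c • x)
      (c • ContinuousLinearMap.id ℝ Plane) K x := fun x _ =>
    ((hasFDerivAt_id x).const_smul c).hasFDerivWithinAt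
  rw [integrableOn_image_iff_integrableOn_abs_det_fderiv_smul volume hK.measurableSet hd
    ((smul_right_injective Plane hc.ne').injOn)] at h1
  have : (c • ContinuousLinearMap.id ℝ Plane).det = c ^ 2 := by
    simp [ContinuousLinearMap.det]
  simp only [this, smul_eq_mul] at h1
  have h2 := h1.const_mul (|c ^ 2|)⁻¹
  have h3 : |c ^ 2| ≠ 0 := by positivity
  simp only [inv_mul_cancel_left₀ h3] at h2
  exact h2

/-- Test the given weak derivative against `ψ(c⁻¹ ·)` and change variables; the area factors cancel
and only the `c ^ |α|` from differentiating the test function remains. -/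
lemma IsWeakDeriv.comp_smul {c : ℝ} (hc : 0 < c) {U : Set Plane} (hU : IsOpen U) {α : ℕ × ℕ}
    {f g : Plane → ℝ} (h : IsWeakDeriv ((fun x : Plane => c • x) '' U) α f g) :
    IsWeakDeriv U α (fun x => f (c • x)) (fun x => c ^ (α.1 + α.2) * g (c • x)) := by
  refine ⟨locallyIntegrableOn_comp_smul hc hU h.1,
    (locallyIntegrableOn_comp_smul hc hU h.2.1).smul (c ^ (α.1 + α.2)), fun ψ h1 h2 h3 => ?_⟩
  have hc' : c⁻¹ ≠ 0 := inv_ne_zero hc.ne'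
  have hts : tsupport (fun x => ψ (c⁻¹ • x)) ⊆ (fun x : Plane => c • x) '' U := by
    have : tsupport (fun x => ψ (c⁻¹ • x)) = (fun x : Plane => c⁻¹ • x) ⁻¹' tsupport ψ :=
      tsupport_comp_eq_preimage ψ (Homeomorph.smulOfNeZero c⁻¹ hc' (α := Plane))
    rw [this]
    intro x hx
    exact ⟨c⁻¹ • x, h3 hx, smul_inv_smul₀ hc.ne' x⟩
  have key := h.2.2 (fun x => ψ (c⁻¹ • x)) (h1.comp (contDiff_const_smul c⁻¹))
    (h2.comp_homeomorph (Homeomorph.smulOfNeZero c⁻¹ hc' (α := Plane))) hts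
  have e : ∀ F : Plane → ℝ, ∫ x in (fun x : Plane => c • x) '' U, F x =
      c ^ 2 * ∫ x in U, F (c • x) := fun F => by
    rw [Measure.setIntegral_comp_smul_of_pos volume F U hc]
    simp only [Module.finrank_fintype_fun_eq_card, Fintype.card_fin, smul_eq_mul]
    rw [mul_inv_cancel_left₀ (by positivity)]
    rfl
  rw [e, e, multiDeriv_comp_smul] at key
  simp only [inv_smul_smul₀ hc.ne'] at key
  have key2 : c ^ (α.1 + α.2) * ∫ x in U, f (c • x) * ((c⁻¹) ^ (α.1 + α.2) * multiDeriv α ψ x) =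
      c ^ (α.1 + α.2) * ((-1) ^ (α.1 + α.2) * ∫ x in U, g (c • x) * ψ x) := by
    congr 1
    have hc2 : c ^ 2 ≠ 0 := by positivity
    refine mul_left_cancel₀ hc2 ?_
    rw [key]; ring
  rw [← integral_const_mul] at key2
  have e1 : ∀ x, c ^ (α.1 + α.2) * (f (c • x) * ((c⁻¹) ^ (α.1 + α.2) * multiDeriv α ψ x)) =
      f (c • x) * multiDeriv α ψ x := fun x => by
    rw [inv_pow]; field_simp
  simp only [e1] at key2
  rw [key2]
  simp only [mul_assoc, integral_const_mul]
  ring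

/-- The factor `c²` is the Jacobian of the dilation and `c ^ (2 * r)` comes from the derivatives.
Both stay as multipliers to avoid division in `ℝ≥0∞`; one direction is enough because only lower
bounds on errors are derived from it. -/
lemma sobolevSemiSq_comp_smul_le {c : ℝ} (hc : 0 < c) {U : Set Plane} (hU : IsOpen U) (r : ℕ)
    (f : Plane → ℝ) :
    ENNReal.ofReal c ^ 2 * sobolevSemiSq r U (fun x => f (c • x)) ≤
      ENNReal.ofReal c ^ (2 * r) * sobolevSemiSq r ((fun x : Plane => c • x) '' U) f := by
  have h0 : ENNReal.ofReal c ≠ 0 := by simpa using hc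
  have h1 : ENNReal.ofReal c ^ (2 * r) ≠ ⊤ := ENNReal.pow_ne_top ENNReal.ofReal_ne_top
  rw [sobolevSemiSq, sobolevSemiSq, ENNReal.mul_iInf_of_ne (pow_ne_zero _ h0) h1]
  refine le_iInf fun g => ?_
  rw [ENNReal.mul_iInf_of_ne (pow_ne_zero _ h0) h1]
  refine le_iInf fun hg => (mul_le_mul_right (iInf₂_le (fun α x => c ^ (α.1 + α.2) * g α (c • x))
    fun α hα => (hg α hα).comp_smul hc hU) _).trans (le_of_eq ?_)
  rw [Finset.mul_sum, Finset.mul_sum]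
  refine Finset.sum_congr rfl fun α hα => ?_
  simp only
  rw [lintegral_image_smul hc hU.measurableSet, Finset.HasAntidiagonal.mem_antidiagonal.1 hα]
  simp only [enorm_mul, mul_pow]
  rw [lintegral_const_mul' _ _ (by simp), Real.enorm_eq_ofReal (by positivity),
    ENNReal.ofReal_pow hc.le]
  ring

/-- Scaling of the error for homogeneous functions. -/
lemma sobolevSemiSq_sub_scaling {c : ℝ} (hc : 0 < c) {U : Set Plane} (hU : IsOpen U) {r d : ℕ}
    (hr : r ≤ d + 1) {φ f : Plane → ℝ} (hφ : ∀ x, φ (c • x) = c ^ d * φ x) :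
    ENNReal.ofReal (c ^ (d + 1 - r)) ^ 2 *
        sobolevSemiSq r U (fun x => φ x - (c ^ d)⁻¹ * f (c • x)) ≤
      sobolevSemiSq r ((fun x : Plane => c • x) '' U) (fun x => φ x - f x) := by
  have hcd : (c ^ d)⁻¹ ≠ 0 := by positivity
  -- Homogeneity turns the rescaled approximation problem into a dilation of the original error.
  have e : (fun x => φ x - (c ^ d)⁻¹ * f (c • x)) =
      fun x => (c ^ d)⁻¹ * ((fun y => φ y - f y) (c • x)) := by
    ext x
    simp only [hφ]
    field_simp
  rw [e]
  have h0 : ENNReal.ofReal c ≠ 0 := by simpa using hc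
  have ht : ENNReal.ofReal c ≠ ⊤ := ENNReal.ofReal_ne_top
  have hp : ∀ n, ENNReal.ofReal c ^ n ≠ 0 := fun n => pow_ne_zero _ h0
  have hq : ∀ n, ENNReal.ofReal c ^ n ≠ ⊤ := fun n => ENNReal.pow_ne_top ht
  have h1 := sobolevSemiSq_const_mul_le r U (fun x => (fun y => φ y - f y) (c • x)) hcd
  have h2 := sobolevSemiSq_comp_smul_le hc hU r (fun y => φ y - f y)
  set X := sobolevSemiSq r ((fun x : Plane => c • x) '' U) (fun x => φ x - f x)
  set Y := sobolevSemiSq r U (fun x => (fun y => φ y - f y) (c • x))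
  have h3 : ‖(c ^ d)⁻¹‖ₑ = (ENNReal.ofReal c ^ d)⁻¹ := by
    rw [enorm_inv (by positivity), Real.enorm_eq_ofReal (by positivity), ENNReal.ofReal_pow hc.le]
  rw [h3] at h1
  refine (mul_le_mul_right h1 _).trans ?_
  rw [ENNReal.ofReal_pow hc.le]
  refine (ENNReal.mul_le_mul_iff_right (hp (2 * r)) (hq (2 * r))).1 ?_
  refine le_trans (le_of_eq ?_) h2
  obtain ⟨m, hm⟩ := Nat.exists_eq_add_of_le hr
  have hm' : d + 1 - r = m := by omega
  rw [hm']
  -- The count of powers: `2r + 2(d + 1 - r) = 2 + 2d`, which uses `r ≤ d + 1`.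
  have h4 : ENNReal.ofReal c ^ (2 * r) * (ENNReal.ofReal c ^ m) ^ 2 =
      ENNReal.ofReal c ^ 2 * (ENNReal.ofReal c ^ d) ^ 2 := by
    rw [← pow_mul, ← pow_mul, ← pow_add, ← pow_add]; congr 1; omega
  calc ENNReal.ofReal c ^ (2 * r) * ((ENNReal.ofReal c ^ m) ^ 2 *
        (((ENNReal.ofReal c ^ d)⁻¹) ^ 2 * Y))
      = (ENNReal.ofReal c ^ (2 * r) * (ENNReal.ofReal c ^ m) ^ 2) *
        (((ENNReal.ofReal c ^ d)⁻¹) ^ 2 * Y) := by ring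
    _ = ENNReal.ofReal c ^ 2 * (ENNReal.ofReal c ^ d * (ENNReal.ofReal c ^ d)⁻¹) ^ 2 * Y := by
        rw [h4]; ring
    _ = _ := by rw [ENNReal.mul_inv_cancel (hp d) (hq d)]; simp

lemma memLp_comp_smul {c : ℝ} (hc : 0 < c) {V W : Set Plane}
    (hVW : (fun x : Plane => c • x) '' V ⊆ W) {f : Plane → ℝ}
    (hf : MemLp f 2 (volume.restrict W)) : MemLp (fun x => f (c • x)) 2 (volume.restrict V) := by
  have hme : MeasurableEmbedding (fun x : Plane => c • x) :=
    (Homeomorph.smulOfNeZero c hc.ne' (α := Plane)).measurableEmbedding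
  have h1 := hf.mono_measure (Measure.restrict_mono_set volume hVW)
  have h2 : (volume.restrict V).map (fun x : Plane => c • x) =
      ENNReal.ofReal |(c ^ Module.finrank ℝ Plane)⁻¹| •
        volume.restrict ((fun x : Plane => c • x) '' V) := by
    rw [← Measure.restrict_smul, ← Measure.map_addHaar_smul volume hc.ne', hme.restrict_map,
      preimage_image_eq _ hme.injective]
  have h3 := h1.smul_measure (c := ENNReal.ofReal |(c ^ Module.finrank ℝ Plane)⁻¹|)
    ENNReal.ofReal_ne_top
  rw [← h2, hme.memLp_map_measure_iff] at h3
  exact h3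

/-! ### Self-similar meshes -/

namespace SelfSimilarGeometry

variable (D : SelfSimilarGeometry)

lemma lam_pow_pos (i : ℕ) : 0 < D.lam ^ i := pow_pos D.lam_pos i

lemma param_eq (i : ℕ) (n : Fin D.N) (u : Plane) :
    D.param i n u = D.lam ^ i • D.param 0 n u := by simp [param]

lemma param_zero (n : Fin D.N) : D.param 0 n = polyMap (D.G n) := by ext; simp [param]

lemma param_image (i : ℕ) (n : Fin D.N) (b : Set Plane) :
    D.param i n '' b = (fun x => D.lam ^ i • x) '' (D.param 0 n '' b) := by
  rw [image_image]
  exact image_congr fun u _ => D.param_eq i n u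

lemma det_jacobianMatrix_ne_zero (n : Fin D.N) {u : Plane} (hu : u ∈ unitSquare) :
    (jacobianMatrix (D.G n) u).det ≠ 0 := D.G_regular n u hu

lemma isOpen_param_image (i : ℕ) (n : Fin D.N) {b : Set Plane} (hb : IsOpen b)
    (hsub : b ⊆ unitSquare) : IsOpen (D.param i n '' b) := by
  rw [param_image, param_zero]
  exact isOpen_image_smul (D.lam_pow_pos i).ne' (isOpen_image_polyMap hb
    fun u hu => D.det_jacobianMatrix_ne_zero n (hsub hu))

lemma isBounded_iUnion_param :
    Bornology.IsBounded (⋃ (i : ℕ) (n : Fin D.N), D.param i n '' unitSquare) := by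
  have h : ∀ n, ∃ C, ∀ u ∈ unitSquare, ‖polyMap (D.G n) u‖ ≤ C := fun n => by
    obtain ⟨C, hC⟩ := isBounded_unitSquare.isCompact_closure.exists_bound_of_continuousOn
      (contDiff_polyMap (D.G n)).continuous.continuousOn
    exact ⟨C, fun u hu => hC u (subset_closure hu)⟩
  choose C hC using h
  rw [isBounded_iff_forall_norm_le]
  refine ⟨∑ n, |C n|, fun x hx => ?_⟩
  simp only [mem_iUnion, mem_image] at hx
  obtain ⟨i, n, u, hu, rfl⟩ := hx
  rw [param, norm_smul, norm_pow, Real.norm_of_nonneg D.lam_pos.le]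
  calc D.lam ^ i * ‖polyMap (D.G n) u‖ ≤ 1 * |C n| :=
        mul_le_mul (pow_le_one₀ D.lam_pos.le D.lam_lt_one.le) ((hC n u hu).trans (le_abs_self _))
          (norm_nonneg _) zero_le_one
    _ = |C n| := one_mul _
    _ ≤ _ := Finset.single_le_sum (f := fun n => |C n|) (fun _ _ => abs_nonneg _)
        (Finset.mem_univ n)

lemma isOpen_Omega : IsOpen D.Omega := isOpen_interior

lemma isBounded_Omega : Bornology.IsBounded D.Omega :=
  D.isBounded_iUnion_param.closure.subset interior_subset

lemma Omega_nonempty : D.Omega.Nonempty := by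
  obtain ⟨u, hu⟩ := unitSquare_nonempty
  have n : Fin D.N := ⟨0, D.N_pos⟩
  refine ⟨D.param 0 n u, ?_⟩
  refine interior_mono (subset_closure.trans' ?_)
    ((D.isOpen_param_image 0 n isOpen_unitSquare subset_rfl).interior_eq.symm ▸
      mem_image_of_mem _ hu)
  exact fun x hx => mem_iUnion₂.2 ⟨0, n, hx⟩

lemma isOpen_dom_ringMesh (p i k : ℕ) (e : Fin D.N × Fin (2 ^ k) × Fin (2 ^ k)) :
    IsOpen (D.ringMesh p i k e).dom :=
  D.isOpen_param_image i e.1 (isOpen_dyadicSquare _ _ _)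
    (dyadicSquare_subset e.2.1.2 e.2.2.2)

lemma isBounded_dom_ringMesh (p i k : ℕ) (e : Fin D.N × Fin (2 ^ k) × Fin (2 ^ k)) :
    Bornology.IsBounded (D.ringMesh p i k e).dom :=
  D.isBounded_iUnion_param.subset fun _ hx => mem_iUnion₂.2
    ⟨i, e.1, image_mono (dyadicSquare_subset e.2.1.2 e.2.2.2) hx⟩

lemma isOpen_dom_cap (W : Submodule ℝ (Plane → ℝ)) (l : ℕ) : IsOpen (D.cap W l).dom :=
  isOpen_image_smul (D.lam_pow_pos _).ne' D.isOpen_Omega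

lemma isBounded_dom_cap (W : Submodule ℝ (Plane → ℝ)) (l : ℕ) :
    Bornology.IsBounded (D.cap W l).dom :=
  (ContinuousLinearMap.lsmul ℝ ℝ (D.lam ^ (l + 1)) : Plane →L[ℝ] Plane).lipschitz.isBounded_image
    D.isBounded_Omega

lemma isOpen_dom_globalMesh (p : ℕ) (W : Submodule ℝ (Plane → ℝ)) (l : ℕ) (e) :
    IsOpen (D.globalMesh p W l e).dom := by
  cases e with
  | none => exact D.isOpen_dom_cap W l
  | some e => exact D.isOpen_dom_ringMesh p _ _ e.2

lemma isBounded_dom_globalMesh (p : ℕ) (W : Submodule ℝ (Plane → ℝ)) (l : ℕ) (e) :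
    Bornology.IsBounded (D.globalMesh p W l e).dom := by
  cases e with
  | none => exact D.isBounded_dom_cap W l
  | some e => exact D.isBounded_dom_ringMesh p _ _ e.2

lemma exists_submodule_element (p i : ℕ) (n : Fin D.N) (b : Set Plane) :
    ∃ S : Submodule ℝ (Plane → ℝ), (D.element p i n b).space = S := by
  refine ⟨{
    carrier := (D.element p i n b).space, add_mem' := ?_, zero_mem' := ?_, smul_mem' := ?_ }, rfl⟩
  · rintro f g ⟨P, hP, hf⟩ ⟨Q, hQ, hg⟩
    exact ⟨P + Q, Submodule.add_mem _ hP hQ, fun u hu => by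
      rw [polyFun_add, Pi.add_apply, hf u hu, hg u hu]⟩
  · exact ⟨0, Submodule.zero_mem _, fun u _ => by simp [polyFun]⟩
  · rintro c f ⟨P, hP, hf⟩
    exact ⟨c • P, Submodule.smul_mem _ c hP, fun u hu => by
      rw [polyFun_smul, Pi.smul_apply, hf u hu, smul_eq_mul]⟩

lemma exists_submodule_cap (W : Submodule ℝ (Plane → ℝ)) (l : ℕ) :
    ∃ S : Submodule ℝ (Plane → ℝ), (D.cap W l).space = S := by
  refine ⟨{
    carrier := (D.cap W l).space, add_mem' := ?_, zero_mem' := ?_, smul_mem' := ?_ }, rfl⟩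
  · rintro f g ⟨s, hs, hf⟩ ⟨t, ht, hg⟩
    exact ⟨s + t, W.add_mem hs ht, fun x hx => by
      rw [Pi.add_apply, Pi.add_apply, hf x hx, hg x hx]⟩
  · exact ⟨0, W.zero_mem, fun u _ => rfl⟩
  · rintro c f ⟨s, hs, hf⟩
    exact ⟨c • s, W.smul_mem c hs, fun x hx => by
      rw [Pi.smul_apply, Pi.smul_apply, hf x hx]⟩

lemma isLinearMesh_globalMesh (p : ℕ) (W : Submodule ℝ (Plane → ℝ)) (l : ℕ) :
    IsLinearMesh (D.globalMesh p W l) := fun e => by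
  cases e with
  | none => exact D.exists_submodule_cap W l
  | some e => exact D.exists_submodule_element p _ _ _

end SelfSimilarGeometry

/-! ### Scaling of best errors and summation over the rings -/

lemma brokenSemi_sq {ι : Type} [Fintype ι] (r : ℕ) (M : ι → MeshElement) (f : Plane → ℝ) :
    brokenSemi r M f ^ 2 = ∑ e, sobolevSemiSq r (M e).dom f := by
  rw [brokenSemi, ← ENNReal.rpow_natCast, ← ENNReal.rpow_mul]
  norm_num

lemma bestError_sq_le {ι : Type} [Fintype ι] {r : ℕ} {M : ι → MeshElement} {φ f : Plane → ℝ}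
    (hf : f ∈ meshSpace M) :
    bestError r M φ ^ 2 ≤ ∑ e, sobolevSemiSq r (M e).dom (fun x => φ x - f x) := by
  rw [← brokenSemi_sq]
  exact pow_le_pow_left' (iInf₂_le f hf) 2

lemma polyFun_smul_of_homogeneous {P : Poly2} {d : ℕ}
    (hP : P ∈ MvPolynomial.homogeneousSubmodule (Fin 2) ℝ d) (c : ℝ) (x : Plane) :
    polyFun P (c • x) = c ^ d * polyFun P x := by
  rw [MvPolynomial.mem_homogeneousSubmodule] at hP
  simp only [polyFun, MvPolynomial.eval_eq', Finset.mul_sum]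
  refine Finset.sum_congr rfl fun m hm => ?_
  have h : m 0 + m 1 = d := by
    rw [← hP (MvPolynomial.mem_support_iff.1 hm), Finsupp.weight_apply,
      Finsupp.sum_fintype _ _ (by simp)]
    simp [Fin.sum_univ_two]
  simp only [Fin.prod_univ_two, Pi.smul_apply, smul_eq_mul, mul_pow, ← h, pow_add]
  ring

namespace SelfSimilarGeometry

variable (D : SelfSimilarGeometry)

/-- The squared broken seminorm on the ring number `i` after `k` bisections. -/
def ringSemiSq (p r i k : ℕ) (f : Plane → ℝ) : ℝ≥0∞ :=
  ∑ e, sobolevSemiSq r (D.ringMesh p i k e).dom f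

lemma ringMesh_dom (p i k : ℕ) (e : Fin D.N × Fin (2 ^ k) × Fin (2 ^ k)) :
    (D.ringMesh p i k e).dom = (fun x => D.lam ^ i • x) '' (D.ringMesh p 0 k e).dom :=
  D.param_image i e.1 _

lemma cap_dom (W : Submodule ℝ (Plane → ℝ)) (l : ℕ) :
    (D.cap W l).dom = (fun x => D.lam ^ l • x) '' (D.cap W 0).dom := by
  simp only [cap, image_image, smul_smul, ← pow_add, zero_add]

variable {D}

lemma scaled_mem_space_ringMesh {p i k : ℕ} {e : Fin D.N × Fin (2 ^ k) × Fin (2 ^ k)}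
    {f : Plane → ℝ} (hf : f ∈ (D.ringMesh p i k e).space) (c : ℝ) :
    (fun x => c * f (D.lam ^ i • x)) ∈ (D.ringMesh p 0 k e).space := by
  obtain ⟨Q, hQ, h⟩ := hf
  refine ⟨c • Q, Submodule.smul_mem _ c hQ, fun u hu => ?_⟩
  simp only [polyFun_smul]
  rw [← h u hu, D.param_eq i]

lemma scaled_mem_space_cap {W : Submodule ℝ (Plane → ℝ)} {l : ℕ}
    {f : Plane → ℝ} (hf : f ∈ (D.cap W l).space) (c : ℝ) :
    (fun x => c * f (D.lam ^ l • x)) ∈ (D.cap W 0).space := by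
  obtain ⟨s, hs, h⟩ := hf
  refine ⟨c • s, W.smul_mem c hs, fun x hx => ?_⟩
  have hx' : D.lam ^ l • x ∈ (D.cap W l).dom := by
    rw [D.cap_dom W l]; exact mem_image_of_mem _ hx
  simp only
  rw [h _ hx', inv_smul_smul₀ (D.lam_pow_pos l).ne']
  simp

lemma scaled_mem_meshSpace_ringMesh {p i k : ℕ} {f : Plane → ℝ}
    (hf : f ∈ meshSpace (D.ringMesh p i k)) (c : ℝ) :
    (fun x => c * f (D.lam ^ i • x)) ∈ meshSpace (D.ringMesh p 0 k) := by
  refine ⟨(memLp_comp_smul (D.lam_pow_pos i) ?_ hf.1).const_mul c,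
    fun e => scaled_mem_space_ringMesh (hf.2 e) c⟩
  rw [image_iUnion]
  exact iUnion_mono fun e => (D.ringMesh_dom p i k e).symm.subset

/-- The rescaled `f` is a competitor on the initial ring with the same number of bisections, so its
error there is at least the best one. -/
lemma bestError_ringMesh_scaling {p r i k d : ℕ} (hr : r ≤ d + 1) {φ f : Plane → ℝ}
    (hφ : ∀ (c : ℝ) x, φ (c • x) = c ^ d * φ x) (hf : f ∈ meshSpace (D.ringMesh p i k)) :
    ENNReal.ofReal ((D.lam ^ i) ^ (d + 1 - r)) ^ 2 * bestError r (D.ringMesh p 0 k) φ ^ 2 ≤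
      D.ringSemiSq p r i k (fun x => φ x - f x) := by
  refine (mul_le_mul_right (bestError_sq_le
    (scaled_mem_meshSpace_ringMesh hf ((D.lam ^ i) ^ d)⁻¹)) _).trans ?_
  rw [Finset.mul_sum, ringSemiSq]
  refine Finset.sum_le_sum fun e _ => ?_
  rw [D.ringMesh_dom p i k e]
  exact sobolevSemiSq_sub_scaling (D.lam_pow_pos i) (D.isOpen_dom_ringMesh p 0 k e) hr (hφ _)

lemma sum_globalMesh (p : ℕ) (W : Submodule ℝ (Plane → ℝ)) (r l : ℕ) (f : Plane → ℝ) :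
    ∑ e, sobolevSemiSq r (D.globalMesh p W l e).dom f =
      sobolevSemiSq r (D.cap W l).dom f +
        ∑ i ∈ Finset.range (l + 1), D.ringSemiSq p r i (l - i) f := by
  rw [Fintype.sum_option, Fintype.sum_sigma,
    Finset.sum_range (fun i => D.ringSemiSq p r i (l - i) f)]
  rfl

lemma mem_meshSpace_ringMesh {p : ℕ} {W : Submodule ℝ (Plane → ℝ)} {l : ℕ} {f : Plane → ℝ}
    (hf : f ∈ meshSpace (D.globalMesh p W l)) {i : ℕ} (hi : i < l + 1) :
    f ∈ meshSpace (D.ringMesh p i (l - i)) := by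
  refine ⟨hf.1.mono_measure (Measure.restrict_mono_set volume ?_),
    fun e => hf.2 (some ⟨⟨i, hi⟩, e⟩)⟩
  exact iUnion_subset fun e => subset_iUnion (fun e => (D.globalMesh p W l e).dom)
    (some ⟨⟨i, hi⟩, e⟩)

/-- At level `l` the last ring is not bisected; together with the cap it is the dilation by `λ ^ l`
of the entire level-0 mesh, local spaces included. -/
lemma scaled_mem_meshSpace_globalMesh {p : ℕ} {W : Submodule ℝ (Plane → ℝ)} {l : ℕ}
    {f : Plane → ℝ} (hf : f ∈ meshSpace (D.globalMesh p W l)) (c : ℝ) :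
    (fun x => c * f (D.lam ^ l • x)) ∈ meshSpace (D.globalMesh p W 0) := by
  have hring : f ∈ meshSpace (D.ringMesh p l 0) := by
    have := mem_meshSpace_ringMesh hf (Nat.lt_succ_self l)
    rwa [Nat.sub_self] at this
  have hcap : f ∈ (D.cap W l).space := hf.2 none
  have hsub : (⋃ e, (D.ringMesh p l 0 e).dom) ⊆ ⋃ e, (D.globalMesh p W l e).dom := by
    have : (⋃ e, (D.ringMesh p l (l - l) e).dom) ⊆ ⋃ e, (D.globalMesh p W l e).dom :=
      iUnion_subset fun e => subset_iUnion (fun e => (D.globalMesh p W l e).dom)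
        (some ⟨⟨l, Nat.lt_succ_self l⟩, e⟩)
    rwa [Nat.sub_self] at this
  refine ⟨(memLp_comp_smul (D.lam_pow_pos l) ?_ hf.1).const_mul c, fun e => ?_⟩
  · rw [image_iUnion]
    refine iUnion_subset fun e => ?_
    cases e with
    | none =>
      refine subset_trans ?_ (subset_iUnion (fun e => (D.globalMesh p W l e).dom) none)
      exact (D.cap_dom W l).symm.subset
    | some e =>
      obtain ⟨⟨i, hi⟩, e⟩ := e
      obtain rfl : i = 0 := by omega
      refine subset_trans ?_ hsub
      exact (D.ringMesh_dom p l 0 e).symm.subset.trans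
        (subset_iUnion (fun e => (D.ringMesh p l 0 e).dom) e)
  · cases e with
    | none => exact scaled_mem_space_cap hcap c
    | some e =>
      obtain ⟨⟨i, hi⟩, e⟩ := e
      obtain rfl : i = 0 := by omega
      exact scaled_mem_space_ringMesh (hring.2 e) c

/-- Treating the last ring and the cap as one block produces the level-0 error itself, hence the
extremal constant with factor 1 instead of a ring constant. -/
lemma bestError_globalMesh_scaling {p r l d : ℕ} {W : Submodule ℝ (Plane → ℝ)} (hr : r ≤ d + 1)
    {φ f : Plane → ℝ} (hφ : ∀ (c : ℝ) x, φ (c • x) = c ^ d * φ x)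
    (hf : f ∈ meshSpace (D.globalMesh p W l)) :
    ENNReal.ofReal ((D.lam ^ l) ^ (d + 1 - r)) ^ 2 * bestError r (D.globalMesh p W 0) φ ^ 2 ≤
      sobolevSemiSq r (D.cap W l).dom (fun x => φ x - f x) +
        D.ringSemiSq p r l 0 (fun x => φ x - f x) := by
  refine (mul_le_mul_right (bestError_sq_le
    (scaled_mem_meshSpace_globalMesh hf ((D.lam ^ l) ^ d)⁻¹)) _).trans ?_
  rw [sum_globalMesh, mul_add]
  refine add_le_add ?_ ?_
  · rw [D.cap_dom W l]
    exact sobolevSemiSq_sub_scaling (D.lam_pow_pos l) (D.isOpen_dom_cap W 0) hr (hφ _)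
  · rw [Finset.sum_range_one, ringSemiSq, Finset.mul_sum, ringSemiSq]
    refine Finset.sum_le_sum fun e _ => ?_
    rw [D.ringMesh_dom p l 0 e]
    exact sobolevSemiSq_sub_scaling (D.lam_pow_pos l) (D.isOpen_dom_ringMesh p 0 0 e) hr (hφ _)

/-- Additivity of the squared seminorm over elements, grouped as the scaling lemmas require: the
rings `i < l`, and the cap with ring `l`. -/
lemma le_bestError_globalMesh {p r l : ℕ} {W : Submodule ℝ (Plane → ℝ)} {φ : Plane → ℝ}
    {x : ℝ≥0∞} (h : ∀ f ∈ meshSpace (D.globalMesh p W l),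
      x ^ 2 ≤ (∑ i ∈ Finset.range l, D.ringSemiSq p r i (l - i) (fun x => φ x - f x)) +
        (sobolevSemiSq r (D.cap W l).dom (fun x => φ x - f x) +
        D.ringSemiSq p r l 0 (fun x => φ x - f x))) :
    x ≤ bestError r (D.globalMesh p W l) φ := by
  refine le_iInf₂ fun f hf => ?_
  refine (ENNReal.pow_le_pow_left_iff (n := 2) (by norm_num)).1 ?_
  rw [brokenSemi_sq, sum_globalMesh, Finset.sum_range_succ, Nat.sub_self]
  refine (h f hf).trans (le_of_eq ?_)
  ring

/-- All rings before the last are discarded. -/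
lemma pow_mul_bestError_le {p r d : ℕ} {W : Submodule ℝ (Plane → ℝ)} (hr : r ≤ d + 1)
    {φ : Plane → ℝ} (hφ : ∀ (c : ℝ) x, φ (c • x) = c ^ d * φ x) (l : ℕ) :
    bestError r (D.globalMesh p W 0) φ * ENNReal.ofReal ((D.lam ^ (d + 1 - r)) ^ l) ≤
      bestError r (D.globalMesh p W l) φ := by
  refine le_bestError_globalMesh fun f hf => ?_
  rw [mul_pow, mul_comm, pow_right_comm D.lam]
  exact (bestError_globalMesh_scaling hr hφ hf).trans le_add_self

/-- Ring `i < l` contributes `c * A ^ i * B ^ (l - i)` and the block of last ring and cap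
contributes `A ^ l`; `min 1 c` is the common factor available in both cases. -/
lemma sqrt_sum_mul_bestError_le {p r d : ℕ} {W : Submodule ℝ (Plane → ℝ)} (hr : r ≤ d + 1)
    {φ : Plane → ℝ} (hφ : ∀ (c : ℝ) x, φ (c • x) = c ^ d * φ x) {A B c : ℝ}
    (hA : A = D.lam ^ (d + 1 - r)) (hB : 0 ≤ B) (hc : 0 ≤ c)
    (h : ∀ k, ENNReal.ofReal (c * B ^ k) * bestError r (D.globalMesh p W 0) φ ≤
      bestError r (D.ringMesh p 0 k) φ) (l : ℕ) :
    ENNReal.ofReal (min 1 c) * bestError r (D.globalMesh p W 0) φ *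
        ENNReal.ofReal (√(∑ i ∈ Finset.range (l + 1), A ^ (2 * i) * B ^ (2 * (l - i)))) ≤
      bestError r (D.globalMesh p W l) φ := by
  have hA0 : 0 ≤ A := hA ▸ (D.lam_pow_pos _).le
  set m := min 1 c with hm
  have hm0 : 0 ≤ m := le_min zero_le_one hc
  set E := bestError r (D.globalMesh p W 0) φ
  refine le_bestError_globalMesh fun f hf => ?_
  have hpow : ∀ i, ENNReal.ofReal ((D.lam ^ i) ^ (d + 1 - r)) = ENNReal.ofReal (A ^ i) := fun i => by
    rw [hA, ← pow_mul, ← pow_mul, mul_comm]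
  have e1 : (ENNReal.ofReal m * E * ENNReal.ofReal
      (√(∑ i ∈ Finset.range (l + 1), A ^ (2 * i) * B ^ (2 * (l - i))))) ^ 2 =
      ∑ i ∈ Finset.range (l + 1), ENNReal.ofReal (m * (A ^ i * B ^ (l - i))) ^ 2 * E ^ 2 := by
    rw [mul_pow, ← ENNReal.ofReal_pow (Real.sqrt_nonneg _), Real.sq_sqrt
      (Finset.sum_nonneg fun i _ => by positivity),
      ENNReal.ofReal_sum_of_nonneg (fun i _ => by positivity), Finset.mul_sum]
    refine Finset.sum_congr rfl fun i _ => ?_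
    rw [ENNReal.ofReal_mul hm0, mul_pow, mul_pow, mul_right_comm, 
      ← ENNReal.ofReal_pow (by positivity : 0 ≤ A ^ i * B ^ (l - i))]
    congr 3; ring
  rw [e1, Finset.sum_range_succ]
  refine add_le_add (Finset.sum_le_sum fun i hi => ?_) ?_
  · have hi' : i < l + 1 := (Finset.mem_range.1 hi).trans (Nat.lt_succ_self l)
    refine le_trans ?_ (bestError_ringMesh_scaling hr hφ (mem_meshSpace_ringMesh hf hi'))
    rw [hpow, ← mul_pow, ← mul_pow]
    refine pow_le_pow_left' ?_ 2
    calc ENNReal.ofReal (m * (A ^ i * B ^ (l - i))) * E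
        ≤ ENNReal.ofReal (A ^ i * (c * B ^ (l - i))) * E := by
          gcongr ?_ * _
          refine ENNReal.ofReal_le_ofReal ?_
          have : m * (A ^ i * B ^ (l - i)) ≤ c * (A ^ i * B ^ (l - i)) :=
            mul_le_mul_of_nonneg_right (min_le_right _ _) (by positivity)
          linarith [this]
      _ = ENNReal.ofReal (A ^ i) * (ENNReal.ofReal (c * B ^ (l - i)) * E) := by
          rw [ENNReal.ofReal_mul (by positivity), mul_assoc]
      _ ≤ _ := by gcongr; exact h _
  · refine le_trans ?_ (bestError_globalMesh_scaling hr hφ hf)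
    rw [hpow]
    gcongr ENNReal.ofReal ?_ ^ 2 * _
    rw [Nat.sub_self, pow_zero, mul_one]
    exact mul_le_of_le_one_left (by positivity) (min_le_left _ _)

end SelfSimilarGeometry

/-! ### Existence of an extremal polynomial -/

/-- A seminorm on a finite-dimensional space is convex, hence continuous, and attains its maximum on
the compact unit sphere; homogeneity extends the bound to all vectors. -/
lemma exists_norm_eq_one_forall_seminorm_le {V : Type*} [NormedAddCommGroup V] [NormedSpace ℝ V]
    [FiniteDimensional ℝ V] [Nontrivial V] (e : Seminorm ℝ V) :
    ∃ v, ‖v‖ = 1 ∧ ∀ w, e w ≤ e v * ‖w‖ := by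
  have hproper : ProperSpace V := FiniteDimensional.proper ℝ V
  have he : Continuous e := (ConvexOn.locallyLipschitz e.convexOn).continuous
  obtain ⟨x, hx⟩ := exists_ne (0 : V)
  have hne : (Metric.sphere (0 : V) 1).Nonempty := NormedSpace.sphere_nonempty.2 zero_le_one
  obtain ⟨v, hv, hmax⟩ := (isCompact_sphere (0 : V) 1).exists_isMaxOn hne he.continuousOn
  refine ⟨v, mem_sphere_zero_iff_norm.1 hv, fun w => ?_⟩
  by_cases hw : w = 0
  · simp [hw]
  have hw' : ‖w‖ ≠ 0 := norm_ne_zero_iff.2 hw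
  have h1 : ‖w‖⁻¹ • w ∈ Metric.sphere (0 : V) 1 := by
    rw [mem_sphere_zero_iff_norm, norm_smul, norm_inv, norm_norm, inv_mul_cancel₀ hw']
  have h2 : e (‖w‖⁻¹ • w) ≤ e v := hmax h1
  rw [map_smul_eq_mul, norm_inv, norm_norm] at h2
  rwa [inv_mul_le_iff₀ (by positivity), mul_comm] at h2

/-- The definite seminorm `n` is installed as the norm of `V`. This yields both the extremal
polynomial and, as a finite-dimensional norm comparison, the inverse inequality. -/
lemma Seminorm.exists_eq_one_forall_le {V : Type*} [AddCommGroup V] [Module ℝ V]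
    [FiniteDimensional ℝ V] [Nontrivial V] (e n : Seminorm ℝ V) (hn : ∀ x, n x = 0 → x = 0) :
    ∃ v, n v = 1 ∧ ∀ w, e w ≤ e v * n w := by
  let _ : Norm V := ⟨n⟩
  have core : NormedSpace.Core ℝ V :=
    { norm_nonneg := fun x => apply_nonneg n x
      norm_smul := fun c x => map_smul_eq_mul n c x
      norm_triangle := fun x y => map_add_le_add n x y
      norm_eq_zero_iff := fun x => ⟨hn x, fun h => by rw [h]; exact map_zero n⟩ }
  let _ : NormedAddCommGroup V := NormedAddCommGroup.ofCore core
  let _ : NormedSpace ℝ V := NormedSpace.ofCore core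
  exact exists_norm_eq_one_forall_seminorm_le e

/-- Finiteness on `V` is what lets an extended-valued functional be read as a real seminorm.
One-sided homogeneity is sufficient, since applying it to `c⁻¹` gives the converse. -/
lemma exists_seminorm_of_functional (V : Submodule ℝ Poly2) (F : (Plane → ℝ) → ℝ≥0∞)
    (hzero : F (fun _ => 0) = 0) (hfin : ∀ P ∈ V, F (polyFun P) < ⊤)
    (hadd : ∀ f g, F (fun x => f x + g x) ≤ F f + F g)
    (hmul : ∀ f (c : ℝ), c ≠ 0 → F (fun x => c * f x) ≤ ‖c‖ₑ * F f) :
    ∃ s : Seminorm ℝ V, ∀ P : V, ENNReal.ofReal (s P) = F (polyFun P) := by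
  have h0 : polyFun 0 = fun _ => 0 := by ext; simp [polyFun]
  refine ⟨Seminorm.ofSMulLE (fun P : V => (F (polyFun P)).toReal) ?_ ?_ ?_, fun P => ?_⟩
  · simp [h0, hzero]
  · intro P Q
    have h := hadd (polyFun P) (polyFun Q)
    rw [← ENNReal.toReal_add (hfin P P.2).ne (hfin Q Q.2).ne]
    refine ENNReal.toReal_mono (ENNReal.add_lt_top.2 ⟨hfin P P.2, hfin Q Q.2⟩).ne ?_
    rwa [← polyFun_add] at h
  · intro c P
    by_cases hc : c = 0
    · simp [hc, h0, hzero]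
    · have h := hmul (polyFun P) c hc
      rw [← polyFun_smul] at h
      have h2 := ENNReal.toReal_mono (ENNReal.mul_lt_top enorm_lt_top (hfin P P.2)).ne h
      rw [ENNReal.toReal_mul] at h2
      simpa using h2
  · exact ENNReal.ofReal_toReal (hfin P P.2).ne

lemma sobolevSemiSq_zero (r : ℕ) (U : Set Plane) : sobolevSemiSq r U (fun _ => 0) = 0 := by
  refine le_antisymm ((sobolevSemiSq_le (g := fun _ _ => 0) fun α _ =>
    ⟨locallyIntegrableOn_zero, locallyIntegrableOn_zero, fun ψ _ _ _ => by simp⟩).trans ?_) zero_le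
  simp

lemma familySemi_zero {ι : Type*} (s : Finset ι) (r : ι → ℕ) (U : ι → Set Plane) :
    familySemi s r U (fun _ => 0) = 0 := by
  simp [familySemi, sobolevSemiSq_zero]

namespace SelfSimilarGeometry

variable (D : SelfSimilarGeometry)

lemma bestError_globalMesh_lt_top (p : ℕ) (W : Submodule ℝ (Plane → ℝ)) (r l : ℕ) (P : Poly2) :
    bestError r (D.globalMesh p W l) (polyFun P) < ⊤ :=
  (bestError_le_brokenSemi (D.isLinearMesh_globalMesh p W l) r _).trans_lt
    (brokenSemi_polyFun_lt_top P (D.isOpen_dom_globalMesh p W l)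
      (D.isBounded_dom_globalMesh p W l) r)

/-- The best error may vanish on nonzero polynomials; only the Sobolev norm has to be definite. The
hypothesis `hpos` supplies both a nontrivial space and a positive quotient. -/
lemma exists_isExtremal (p κ : ℕ) (W : Submodule ℝ (Plane → ℝ)) (r : ℕ)
    (hpos : ∃ P ∈ MvPolynomial.homogeneousSubmodule (Fin 2) ℝ (κ + 1),
      0 < bestError r (D.globalMesh p W 0) (polyFun P)) :
    0 < D.extremalConst p κ W r ∧ D.extremalConst p κ W r < ⊤ ∧
      ∃ φ, D.IsExtremal p κ W r φ := by
  set V := MvPolynomial.homogeneousSubmodule (Fin 2) ℝ (κ + 1) with hV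
  set E : (Plane → ℝ) → ℝ≥0∞ := bestError r (D.globalMesh p W 0) with hE
  set S : (Plane → ℝ) → ℝ≥0∞ := sobolevNorm (p + 1) D.Omega with hS
  have hlin := D.isLinearMesh_globalMesh p W 0
  have hE0 : E (fun _ => 0) = 0 := by
    refine le_antisymm ((bestError_le_brokenSemi hlin r _).trans (le_of_eq ?_)) zero_le
    rw [brokenSemi_eq_familySemi]
    exact familySemi_zero _ _ _
  have hS0 : S (fun _ => 0) = 0 := by
    rw [hS, sobolevNorm_eq_familySemi]
    exact familySemi_zero _ _ _
  have hSfin : ∀ P, S (polyFun P) < ⊤ := fun P =>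
    sobolevNorm_polyFun_lt_top P D.isOpen_Omega D.isBounded_Omega _
  have hSne : ∀ P, P ≠ 0 → S (polyFun P) ≠ 0 := fun P hP =>
    sobolevNorm_polyFun_ne_zero hP D.isOpen_Omega D.Omega_nonempty _
  obtain ⟨e, he⟩ := exists_seminorm_of_functional V E hE0
    (fun P _ => D.bestError_globalMesh_lt_top p W r 0 P) (bestError_add_le hlin r)
    (fun f c hc => bestError_const_mul_le hlin r f hc)
  obtain ⟨n, hn⟩ := exists_seminorm_of_functional V S hS0
    (fun P _ => hSfin P) (fun f g => by
      simp only [hS, sobolevNorm_eq_familySemi]; exact familySemi_add_le _ _ _ f g)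
    (fun f c hc => by
      simp only [hS, sobolevNorm_eq_familySemi]; exact familySemi_const_mul_le _ _ _ f hc)
  have hndef : ∀ x, n x = 0 → x = 0 := fun x hx => by
    by_contra hne
    refine hSne x (fun h => hne (Subtype.ext h)) ?_
    rw [← hn, hx, ENNReal.ofReal_zero]
  have : FiniteDimensional ℝ V :=
    Module.Finite.of_fg (MvPolynomial.homogeneousSubmodule_fg (Fin 2) ℝ (κ + 1))
  obtain ⟨P₀, hP₀, hpos₀⟩ := hpos
  have hP₀ne : P₀ ≠ 0 := fun h => by
    rw [h, show polyFun 0 = fun _ => 0 by ext; simp [polyFun]] at hpos₀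
    exact hpos₀.ne' hE0
  have : Nontrivial V := ⟨⟨⟨P₀, hP₀⟩, 0, fun h => hP₀ne (congrArg Subtype.val h)⟩⟩
  obtain ⟨v, hv1, hvmax⟩ := Seminorm.exists_eq_one_forall_le e n hndef
  have hSv : S (polyFun v) = 1 := by rw [← hn, hv1, ENNReal.ofReal_one]
  have hvne : (v : Poly2) ≠ 0 := fun h => by
    have : v = 0 := Subtype.ext h
    rw [this, map_zero] at hv1
    exact zero_ne_one hv1
  have hC : D.extremalConst p κ W r = E (polyFun v) := by
    refine le_antisymm (iSup_le fun P => iSup₂_le fun hP hPne => ?_) ?_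
    · refine ENNReal.div_le_of_le_mul ?_
      change E (polyFun P) ≤ E (polyFun v) * S (polyFun P)
      rw [← he ⟨P, hP⟩, ← hn ⟨P, hP⟩, ← he v, ← ENNReal.ofReal_mul (apply_nonneg e v)]
      exact ENNReal.ofReal_le_ofReal (hvmax _)
    · have : E (polyFun v) = E (polyFun v) / S (polyFun v) := by rw [hSv, div_one]
      rw [this]
      exact le_iSup_of_le (v : Poly2) (le_iSup₂_of_le v.2 hvne le_rfl)
  refine ⟨?_, ?_, v, v.2, hSv, hC.symm⟩
  · refine lt_of_lt_of_le ?_ (le_iSup_of_le P₀ (le_iSup₂_of_le hP₀ hP₀ne le_rfl))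
    exact ENNReal.div_pos hpos₀.ne' (hSfin P₀).ne
  · rw [hC]
    exact D.bestError_globalMesh_lt_top p W r 0 v

end SelfSimilarGeometry

/-! ### Degrees of derivatives -/

lemma totalDegree_pderiv_le (i : Fin 2) (P : Poly2) :
    (MvPolynomial.pderiv i P).totalDegree ≤ P.totalDegree := by
  refine Finset.sup_le fun m hm => ?_
  rw [MvPolynomial.mem_support_iff, MvPolynomial.coeff_pderiv] at hm
  have h := MvPolynomial.le_totalDegree (MvPolynomial.mem_support_iff.2 (left_ne_zero_of_mul hm))
  refine le_trans ?_ h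
  rw [Finsupp.sum_add_index' (by simp) (by simp)]
  exact Nat.le_add_right _ _

/-- Each derivative shifts the exponent of `X_a` down by one and multiplies the coefficient by that
exponent, which is nonzero in characteristic 0 unless the monomial is already free of `X_a`. -/
lemma iterate_pderiv_eq_zero_iff (a : Fin 2) (k : ℕ) (P : Poly2) :
    (MvPolynomial.pderiv a)^[k] P = 0 ↔ ∀ s ∈ P.support, s a < k := by
  induction k generalizing P with
  | zero =>
    simp only [Function.iterate_zero, id_eq, not_lt_zero, imp_false]
    rw [← MvPolynomial.support_eq_empty, Finset.eq_empty_iff_forall_notMem]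
  | succ k ih =>
    rw [Function.iterate_succ_apply, ih]
    constructor
    · intro h s hs
      by_cases h0 : s a = 0
      · omega
      · have e : s = (s - Finsupp.single a 1) + Finsupp.single a 1 := by
          rw [tsub_add_cancel_of_le]
          exact Finsupp.single_le_iff.2 (Nat.one_le_iff_ne_zero.2 h0)
        have hm := h (s - Finsupp.single a 1) (by
          rw [MvPolynomial.mem_support_iff, MvPolynomial.coeff_pderiv, ← e]
          exact mul_ne_zero (MvPolynomial.mem_support_iff.1 hs) (by positivity))
        rw [e]
        simp only [Finsupp.add_apply, Finsupp.single_eq_same]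
        omega
    · intro h m hm
      rw [MvPolynomial.mem_support_iff, MvPolynomial.coeff_pderiv] at hm
      have := h _ (MvPolynomial.mem_support_iff.2 (left_ne_zero_of_mul hm))
      simp only [Finsupp.add_apply, Finsupp.single_eq_same] at this
      omega

lemma iterate_pderiv_eq_zero_of_mem_restrictDegree {p : ℕ} {Q : Poly2}
    (hQ : Q ∈ MvPolynomial.restrictDegree (Fin 2) ℝ p) (a : Fin 2) :
    (MvPolynomial.pderiv a)^[p + 1] Q = 0 :=
  (iterate_pderiv_eq_zero_iff a _ Q).2 fun s hs =>
    Nat.lt_succ_of_le ((MvPolynomial.mem_restrictDegree _ _ _).1 hQ s hs a)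

/-- Provides the derivative that separates `φ ∘ G` from the local space, all of whose elements it
annihilates. -/
lemma exists_iterate_pderiv_ne_zero {p : ℕ} {Q : Poly2}
    (hQ : Q ∉ MvPolynomial.restrictDegree (Fin 2) ℝ p) :
    ∃ a, (MvPolynomial.pderiv a)^[p + 1] Q ≠ 0 := by
  by_contra! h
  exact hQ ((MvPolynomial.mem_restrictDegree _ _ _).2 fun s hs a =>
    Nat.lt_succ_iff.1 ((iterate_pderiv_eq_zero_iff a _ Q).1 (h a) s hs))

/-- The polynomial `P(a + c u)`. -/
def affineComp (a : Plane) (c : ℝ) (P : Poly2) : Poly2 :=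
  MvPolynomial.bind₁ (fun i => MvPolynomial.C (a i) + MvPolynomial.C c * MvPolynomial.X i) P

lemma polyFun_affineComp (a : Plane) (c : ℝ) (P : Poly2) (u : Plane) :
    polyFun (affineComp a c P) u = polyFun P (a + c • u) := by
  simp only [polyFun, affineComp, ← MvPolynomial.coe_aeval_eq_eval, RingHom.coe_coe,
    MvPolynomial.aeval_bind₁]
  congr 2
  ext i
  simp

lemma totalDegree_affineComp_le (a : Plane) (c : ℝ) (P : Poly2) :
    (affineComp a c P).totalDegree ≤ P.totalDegree := by
  have e : affineComp a c P = ∑ m ∈ P.support, MvPolynomial.C (P.coeff m) *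
      ∏ i, (MvPolynomial.C (a i) + MvPolynomial.C c * MvPolynomial.X i) ^ m i := by
    rw [affineComp, MvPolynomial.bind₁, MvPolynomial.aeval_def, MvPolynomial.eval₂_eq']
    rfl
  rw [e]
  refine MvPolynomial.totalDegree_finsetSum_le fun m hm => ?_
  refine (MvPolynomial.totalDegree_mul _ _).trans ?_
  rw [MvPolynomial.totalDegree_C, zero_add]
  have hdeg : ∑ i, m i ≤ P.totalDegree := by
    have := MvPolynomial.le_totalDegree hm
    rwa [Finsupp.sum_fintype _ _ (fun _ => rfl)] at this
  refine (MvPolynomial.totalDegree_finsetProd _ _).trans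
    ((Finset.sum_le_sum fun i _ => ?_).trans hdeg)
  refine (MvPolynomial.totalDegree_pow _ _).trans (mul_le_of_le_one_right (Nat.zero_le _) ?_)
  refine (MvPolynomial.totalDegree_add _ _).trans (max_le (by simp) ?_)
  refine (MvPolynomial.totalDegree_mul _ _).trans ?_
  simp

/-! ### The inverse inequality -/

/-- On the finite-dimensional space of polynomials of bounded degree every seminorm is controlled by
the `L²` norm. -/
lemma exists_sobolevSemiSq_one_le (d : ℕ) : ∃ C : ℝ≥0∞, C ≠ ⊤ ∧ ∀ P : Poly2, P.totalDegree ≤ d →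
    familySemi {()} (fun _ => 1) (fun _ => unitSquare) (polyFun P) ≤
      C * sobolevNorm 0 unitSquare (polyFun P) := by
  set V := MvPolynomial.restrictTotalDegree (Fin 2) ℝ d
  obtain ⟨e, he⟩ := exists_seminorm_of_functional V
    (familySemi {()} (fun _ => 1) (fun _ => unitSquare)) (familySemi_zero _ _ _)
    (fun P _ => by
      rw [familySemi]
      exact ENNReal.rpow_lt_top_of_nonneg (by norm_num) (ENNReal.sum_lt_top.2 fun _ _ =>
        sobolevSemiSq_polyFun_lt_top P isOpen_unitSquare isBounded_unitSquare _).ne)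
    (familySemi_add_le _ _ _) (fun f c hc => familySemi_const_mul_le _ _ _ f hc)
  obtain ⟨n, hn⟩ := exists_seminorm_of_functional V (sobolevNorm 0 unitSquare)
    (familySemi_zero _ _ _)
    (fun P _ => sobolevNorm_polyFun_lt_top P isOpen_unitSquare isBounded_unitSquare _)
    (familySemi_add_le _ _ _) (fun f c hc => familySemi_const_mul_le _ _ _ f hc)
  have hndef : ∀ x, n x = 0 → x = 0 := fun x hx => by
    by_contra hne
    refine sobolevNorm_polyFun_ne_zero (fun h => hne (Subtype.ext h)) isOpen_unitSquare
      unitSquare_nonempty 0 ?_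
    rw [← hn, hx, ENNReal.ofReal_zero]
  have : Nontrivial V := by
    refine ⟨⟨⟨1, (MvPolynomial.mem_restrictTotalDegree _ _ _).2 (by simp)⟩, 0, fun h => ?_⟩⟩
    exact one_ne_zero (congrArg Subtype.val h)
  obtain ⟨v, -, hv⟩ := Seminorm.exists_eq_one_forall_le e n hndef
  refine ⟨ENNReal.ofReal (e v), ENNReal.ofReal_ne_top, fun P hP => ?_⟩
  have hP' : P ∈ V := (MvPolynomial.mem_restrictTotalDegree _ _ _).2 hP
  rw [← he ⟨P, hP'⟩, ← hn ⟨P, hP'⟩, ← ENNReal.ofReal_mul (apply_nonneg e v)]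
  exact ENNReal.ofReal_le_ofReal (hv _)

lemma exists_eLpNorm_pderiv_unitSquare_le (d : ℕ) : ∃ C : ℝ≥0∞, C ≠ ⊤ ∧ ∀ P : Poly2,
    P.totalDegree ≤ d → ∀ i,
    eLpNorm (polyFun (MvPolynomial.pderiv i P)) 2 (volume.restrict unitSquare) ≤
      C * eLpNorm (polyFun P) 2 (volume.restrict unitSquare) := by
  obtain ⟨C, hC, h⟩ := exists_sobolevSemiSq_one_le d
  refine ⟨C, hC, fun P hP i => le_trans ?_ ((h P hP).trans (le_of_eq ?_))⟩
  · rw [familySemi, Finset.sum_singleton, ← lintegral_sq_rpow_half,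
      sobolevSemiSq_of_contDiffOn isOpen_unitSquare (contDiff_polyFun P).contDiffOn]
    refine ENNReal.rpow_le_rpow ?_ (by norm_num)
    have hmem : unitIndex i ∈ Finset.HasAntidiagonal.antidiagonal 1 := by
      fin_cases i <;> simp [unitIndex]
    refine le_trans (le_of_eq ?_) (Finset.single_le_sum (fun _ _ => zero_le) hmem)
    rw [multiDeriv_polyFun]
    fin_cases i <;> simp [unitIndex]
  · rw [← lintegral_sq_rpow_half, sobolevNorm]
    simp [sobolevSemiSq_of_contDiffOn isOpen_unitSquare (contDiff_polyFun P).contDiffOn,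
      multiDeriv]

lemma dyadicSquare_eq_image (k j₁ j₂ : ℕ) :
    dyadicSquare k j₁ j₂ =
      (fun u : Plane => ![(j₁ : ℝ) / 2 ^ k, (j₂ : ℝ) / 2 ^ k] + ((2 : ℝ) ^ k)⁻¹ • u) '' unitSquare := by
  have h2 : (0 : ℝ) < 2 ^ k := by positivity
  ext u
  simp only [dyadicSquare, unitSquare, mem_ofPred_eq, mem_image]
  constructor
  · rintro ⟨h1, h3, h4, h5⟩
    refine ⟨![2 ^ k * u 0 - j₁, 2 ^ k * u 1 - j₂], ?_, ?_⟩
    · rw [div_lt_iff₀ h2] at h1 h4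
      rw [lt_div_iff₀ h2] at h3 h5
      simp only [Matrix.cons_val_zero, Matrix.cons_val_one]
      refine ⟨?_, ?_, ?_, ?_⟩ <;> linarith
    · ext i
      fin_cases i <;> simp <;> field_simp <;> ring
  · rintro ⟨v, ⟨h1, h3, h4, h5⟩, rfl⟩
    simp only [Pi.add_apply, Pi.smul_apply, smul_eq_mul, Matrix.cons_val_zero, Matrix.cons_val_one]
    refine ⟨?_, ?_, ?_, ?_⟩
    · have : 0 < ((2 : ℝ) ^ k)⁻¹ * v 0 := by positivity
      linarith
    · rw [add_div, div_eq_inv_mul 1]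
      have : ((2 : ℝ) ^ k)⁻¹ * v 0 < ((2 : ℝ) ^ k)⁻¹ * 1 :=
        mul_lt_mul_of_pos_left h3 (by positivity)
      linarith
    · have : 0 < ((2 : ℝ) ^ k)⁻¹ * v 1 := by positivity
      linarith
    · rw [add_div, div_eq_inv_mul 1]
      have : ((2 : ℝ) ^ k)⁻¹ * v 1 < ((2 : ℝ) ^ k)⁻¹ * 1 :=
        mul_lt_mul_of_pos_left h5 (by positivity)
      linarith

lemma eLpNorm_image_affine (a : Plane) {c : ℝ} (hc : 0 < c) {U : Set Plane}
    (hU : MeasurableSet U) (F : Plane → ℝ) :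
    eLpNorm F 2 (volume.restrict ((fun x : Plane => a + c • x) '' U)) =
      ENNReal.ofReal c * eLpNorm (fun x => F (a + c • x)) 2 (volume.restrict U) := by
  rw [← lintegral_sq_rpow_half, ← lintegral_sq_rpow_half, lintegral_image_affine a hc hU,
    ENNReal.mul_rpow_of_nonneg _ _ (by norm_num), ← ENNReal.rpow_natCast, ← ENNReal.rpow_mul]
  norm_num

/-- The inverse inequality on dyadic squares. -/
lemma exists_eLpNorm_pderiv_le (d : ℕ) : ∃ C : ℝ≥0∞, C ≠ ⊤ ∧ ∀ k j₁ j₂, ∀ P : Poly2,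
    P.totalDegree ≤ d → ∀ i,
    eLpNorm (polyFun (MvPolynomial.pderiv i P)) 2 (volume.restrict (dyadicSquare k j₁ j₂)) ≤
      C * ENNReal.ofReal (2 ^ k) * eLpNorm (polyFun P) 2 (volume.restrict (dyadicSquare k j₁ j₂)) := by
  obtain ⟨C, hC, h⟩ := exists_eLpNorm_pderiv_unitSquare_le d
  refine ⟨C, hC, fun k j₁ j₂ P hP i => ?_⟩
  have hh : (0 : ℝ) < ((2 : ℝ) ^ k)⁻¹ := by positivity
  rw [dyadicSquare_eq_image, eLpNorm_image_affine _ hh isOpen_unitSquare.measurableSet,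
    eLpNorm_image_affine _ hh isOpen_unitSquare.measurableSet]
  set a : Plane := ![(j₁ : ℝ) / 2 ^ k, (j₂ : ℝ) / 2 ^ k]
  have key := h (affineComp a ((2 : ℝ) ^ k)⁻¹ P) ((totalDegree_affineComp_le _ _ _).trans hP) i
  have e1 : polyFun (affineComp a ((2 : ℝ) ^ k)⁻¹ P) =
      fun u => polyFun P (a + ((2 : ℝ) ^ k)⁻¹ • u) := funext fun u => polyFun_affineComp _ _ _ _
  have e2 : polyFun (MvPolynomial.pderiv i (affineComp a ((2 : ℝ) ^ k)⁻¹ P)) =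
      ((2 : ℝ) ^ k)⁻¹ • fun u => polyFun (MvPolynomial.pderiv i P) (a + ((2 : ℝ) ^ k)⁻¹ • u) := by
    rw [← partialDeriv_polyFun, e1,
      partialDeriv_comp_smul ((2 : ℝ) ^ k)⁻¹ i (fun y => polyFun P (a + y)),
      ← partialDeriv_polyFun]
    ext u
    simp only [partialDeriv, Pi.smul_apply, smul_eq_mul, fderiv_comp_add_left]
  rw [e2, e1, eLpNorm_const_smul, Real.enorm_eq_ofReal hh.le] at key
  calc _ ≤ C * eLpNorm (fun x => polyFun P (a + ((2 : ℝ) ^ k)⁻¹ • x)) 2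
        (volume.restrict unitSquare) := key
    _ = _ := by
      have : ENNReal.ofReal (2 ^ k) * ENNReal.ofReal ((2 : ℝ) ^ k)⁻¹ = 1 := by
        rw [← ENNReal.ofReal_mul (by positivity), mul_inv_cancel₀ (by positivity),
          ENNReal.ofReal_one]
      rw [mul_assoc, ← mul_assoc (ENNReal.ofReal _), this, one_mul]

/-! ### The chain rule in polynomial coordinates -/

/-- The Jacobian matrix of a polynomial map, with polynomial entries. -/
def jacobianPolyMatrix (G : Fin 2 → Poly2) : Matrix (Fin 2) (Fin 2) Poly2 :=
  Matrix.of fun a b => MvPolynomial.pderiv b (G a)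

/-- The Jacobian determinant of a polynomial map, as a polynomial. -/
def jacobianPoly (G : Fin 2 → Poly2) : Poly2 := (jacobianPolyMatrix G).det

lemma polyFun_jacobianPoly (G : Fin 2 → Poly2) (u : Plane) :
    polyFun (jacobianPoly G) u = (jacobianMatrix G u).det := by
  simp [polyFun, jacobianPoly, jacobianPolyMatrix, jacobianMatrix, Matrix.det_fin_two]

lemma partialDeriv_mul {f g : Plane → ℝ} {u : Plane} (hf : DifferentiableAt ℝ f u)
    (hg : DifferentiableAt ℝ g u) (k : Fin 2) :
    partialDeriv k (fun x => f x * g x) u =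
      partialDeriv k f u * g u + f u * partialDeriv k g u := by
  simp only [partialDeriv]
  rw [fderiv_fun_mul hf hg]
  simp only [add_apply, smul_apply, smul_eq_mul]
  ring

lemma differentiableAt_polyFun (P : Poly2) (u : Plane) : DifferentiableAt ℝ (polyFun P) u :=
  (hasFDerivAt_polyFun P u).differentiableAt

lemma partialDeriv_comp_polyMap (G : Fin 2 → Poly2) {g : Plane → ℝ} {u : Plane}
    (hg : DifferentiableAt ℝ g (polyMap G u)) (k : Fin 2) :
    partialDeriv k (fun x => g (polyMap G x)) u =
      ∑ i, polyFun (MvPolynomial.pderiv k (G i)) u * partialDeriv i g (polyMap G u) := by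
  have h := hg.hasFDerivAt.comp u (hasFDerivAt_polyMap G u)
  have h' : fderiv ℝ (fun x => g (polyMap G x)) u = _ := h.fderiv
  simp only [partialDeriv]
  rw [h']
  have e : polyMapDeriv G u (Pi.single k 1) =
      ∑ i, polyFun (MvPolynomial.pderiv k (G i)) u • (Pi.single i 1 : Plane) := by
    ext a
    simp only [polyMapDeriv, jacobianMatrix, LinearMap.coe_toContinuousLinearMap',
      Matrix.toLin'_apply, Matrix.mulVec_single_one, Matrix.col_apply, Matrix.of_apply, polyFun]
    fin_cases a <;> simp [Fin.sum_univ_two]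
  rw [ContinuousLinearMap.comp_apply, e, map_sum]
  simp only [map_smul, smul_eq_mul]

/-- If `J ^ s * (g ∘ G)` is the polynomial `P`, then `J ^ (s + 2) * (∂_j g ∘ G)` is the polynomial
`jacobianStep G s j P`. -/
def jacobianStep (G : Fin 2 → Poly2) (s : ℕ) (j : Fin 2) (P : Poly2) : Poly2 :=
  ∑ k, ((jacobianPolyMatrix G).adjugate k j * jacobianPoly G * MvPolynomial.pderiv k P -
    (s : ℝ) • ((jacobianPolyMatrix G).adjugate k j * MvPolynomial.pderiv k (jacobianPoly G)) * P)

/-- Differentiating `P = J^(s+1) (g ∘ G)` and forming `J ∂_k P - (s+1) (∂_k J) P` cancels the terms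
in `g ∘ G`, leaving `J^(s+2) ∑ ∂_k G_i (∂_i g ∘ G)`. The adjugate of the Jacobian matrix then
isolates `∂_j g` at the cost of one more `J`, without any division. -/
lemma polyFun_jacobianStep {G : Fin 2 → Poly2} {s : ℕ} {b : Set Plane} (hb : IsOpen b)
    {g : Plane → ℝ} (hg : ∀ u ∈ b, DifferentiableAt ℝ g (polyMap G u)) {P : Poly2}
    (hP : ∀ u ∈ b, polyFun P u = polyFun (jacobianPoly G) u ^ (s + 1) * g (polyMap G u))
    (j : Fin 2) {u : Plane} (hu : u ∈ b) :
    polyFun (jacobianStep G (s + 1) j P) u =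
      polyFun (jacobianPoly G) u ^ (s + 3) * partialDeriv j g (polyMap G u) := by
  have hd : ∀ k, polyFun (MvPolynomial.pderiv k P) u =
      ((s + 1 : ℕ) : ℝ) * polyFun (jacobianPoly G) u ^ s *
        polyFun (MvPolynomial.pderiv k (jacobianPoly G)) u * g (polyMap G u) +
      polyFun (jacobianPoly G) u ^ (s + 1) *
        ∑ i, polyFun (MvPolynomial.pderiv k (G i)) u * partialDeriv i g (polyMap G u) := by
    intro k
    have e1 : polyFun (jacobianPoly G ^ (s + 1)) = fun x => polyFun (jacobianPoly G) x ^ (s + 1) := by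
      ext x; simp [polyFun]
    have hgc : DifferentiableAt ℝ (fun x => g (polyMap G x)) u :=
      (hg u hu).comp u (hasFDerivAt_polyMap G u).differentiableAt
    rw [← partialDeriv_polyFun, partialDeriv_eqOn hb (g := fun x =>
      polyFun (jacobianPoly G ^ (s + 1)) x * g (polyMap G x))
      (fun x hx => by rw [e1]; exact hP x hx) k hu,
      partialDeriv_mul (differentiableAt_polyFun _ _) hgc,
      partialDeriv_comp_polyMap G (hg u hu), partialDeriv_polyFun, e1]
    congr 2
    simp [polyFun, Derivation.leibniz_pow]
    ring
  have hJ : polyFun (jacobianPoly G) u =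
      polyFun (MvPolynomial.pderiv 0 (G 0)) u * polyFun (MvPolynomial.pderiv 1 (G 1)) u -
      polyFun (MvPolynomial.pderiv 1 (G 0)) u * polyFun (MvPolynomial.pderiv 0 (G 1)) u := by
    simp [polyFun, jacobianPoly, jacobianPolyMatrix, Matrix.det_fin_two]
  have hstep : polyFun (jacobianStep G (s + 1) j P) u =
      ∑ k, polyFun ((jacobianPolyMatrix G).adjugate k j) u *
        (polyFun (jacobianPoly G) u * polyFun (MvPolynomial.pderiv k P) u -
        ((s + 1 : ℕ) : ℝ) * polyFun (MvPolynomial.pderiv k (jacobianPoly G)) u * polyFun P u) := by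
    simp only [polyFun, jacobianStep, map_sum, map_sub, map_mul, MvPolynomial.smul_eval]
    exact Finset.sum_congr rfl fun k _ => by ring
  rw [hstep]
  simp only [hd, hP u hu]
  have hmain : ∀ k, polyFun (jacobianPoly G) u * (((s + 1 : ℕ) : ℝ) * polyFun (jacobianPoly G) u ^ s *
        polyFun (MvPolynomial.pderiv k (jacobianPoly G)) u * g (polyMap G u) +
      polyFun (jacobianPoly G) u ^ (s + 1) *
        ∑ i, polyFun (MvPolynomial.pderiv k (G i)) u * partialDeriv i g (polyMap G u)) -
      ((s + 1 : ℕ) : ℝ) * polyFun (MvPolynomial.pderiv k (jacobianPoly G)) u *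
        (polyFun (jacobianPoly G) u ^ (s + 1) * g (polyMap G u)) =
      polyFun (jacobianPoly G) u ^ (s + 2) *
        ∑ i, polyFun (MvPolynomial.pderiv k (G i)) u * partialDeriv i g (polyMap G u) := fun k => by
    ring
  simp only [Fin.sum_univ_two] at hmain ⊢
  rw [hmain, hmain]
  rw [pow_succ _ (s + 2)]
  fin_cases j
  · simp [Matrix.adjugate_fin_two, jacobianPolyMatrix, polyFun] at hJ ⊢
    rw [hJ]; ring
  · simp [Matrix.adjugate_fin_two, jacobianPolyMatrix, polyFun] at hJ ⊢
    rw [hJ]; ring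

/-! ### Derivatives of a composition -/

/-- The value at `u` of the differential operator with polynomial coefficients `w`, applied to `f`
at `G u`. -/
def evalOperator (G : Fin 2 → Poly2) (f : Plane → ℝ) (u : Plane) : (ℕ × ℕ →₀ Poly2) →+ ℝ :=
  Finsupp.liftAddHom fun α => (AddMonoidHom.mulRight (multiDeriv α f (polyMap G u))).comp
    (MvPolynomial.eval u : Poly2 →+* ℝ).toAddMonoidHom

lemma evalOperator_apply (G : Fin 2 → Poly2) (f : Plane → ℝ) (u : Plane) (w : ℕ × ℕ →₀ Poly2) :
    evalOperator G f u w =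
      ∑ α ∈ w.support, polyFun (w α) u * multiDeriv α f (polyMap G u) := rfl

lemma evalOperator_single (G : Fin 2 → Poly2) (f : Plane → ℝ) (u : Plane) (α : ℕ × ℕ) (c : Poly2) :
    evalOperator G f u (Finsupp.single α c) = polyFun c u * multiDeriv α f (polyMap G u) := by
  rw [evalOperator, Finsupp.liftAddHom_apply_single]
  rfl

/-- The chain and product rules by induction on the order. The coefficients do not depend on `f`, so
they can be identified on global polynomials and then used for errors that are smooth only on one
element. -/
lemma exists_operator_comp_polyMap (G : Fin 2 → Poly2) (a : Fin 2) (k : ℕ) :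
    ∃ w : ℕ × ℕ →₀ Poly2, (∀ α ∈ w.support, α.1 + α.2 ≤ k) ∧
      ∀ (V : Set Plane), IsOpen V → ∀ f : Plane → ℝ, ContDiffOn ℝ ∞ f V →
        ∀ u, polyMap G u ∈ V →
          (partialDeriv a)^[k] (fun x => f (polyMap G x)) u = evalOperator G f u w := by
  induction k with
  | zero =>
    refine ⟨Finsupp.single (0, 0) 1, fun α hα => ?_, fun V _ f _ u _ => ?_⟩
    · have := Finsupp.support_single_subset hα
      rw [Finset.mem_singleton] at this
      simp [this]
    · rw [evalOperator_single]
      simp [polyFun, multiDeriv]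
  | succ k ih =>
    obtain ⟨w, hw, h⟩ := ih
    refine ⟨∑ α ∈ w.support, (Finsupp.single α (MvPolynomial.pderiv a (w α)) +
      ∑ i, Finsupp.single (α + unitIndex i) (w α * MvPolynomial.pderiv a (G i))), ?_, ?_⟩
    · have hmem : (∑ α ∈ w.support, (Finsupp.single α (MvPolynomial.pderiv a (w α)) +
          ∑ i, Finsupp.single (α + unitIndex i) (w α * MvPolynomial.pderiv a (G i)))) ∈
          Finsupp.supported Poly2 Poly2 {α : ℕ × ℕ | α.1 + α.2 ≤ k + 1} := by
        refine Submodule.sum_mem _ fun α hα => Submodule.add_mem _ ?_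
          (Submodule.sum_mem _ fun i _ => ?_)
        · exact Finsupp.single_mem_supported _ _ ((hw α hα).trans (Nat.le_succ k))
        · refine Finsupp.single_mem_supported _ _ ?_
          have := hw α hα
          fin_cases i <;> simp [unitIndex] <;> omega
      exact fun α hα => (Finsupp.mem_supported _ _).1 hmem hα
    · intro V hV f hf u hu
      have hopen : IsOpen (polyMap G ⁻¹' V) := hV.preimage (contDiff_polyMap G).continuous
      have hd : ∀ α, DifferentiableAt ℝ (multiDeriv α f) (polyMap G u) := fun α =>
        differentiableAt_of_contDiffOn hV (contDiffOn_multiDeriv hV hf α) hu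
      have hd' : ∀ α, DifferentiableAt ℝ (fun x => multiDeriv α f (polyMap G x)) u := fun α =>
        (hd α).comp u (hasFDerivAt_polyMap G u).differentiableAt
      rw [Function.iterate_succ_apply', partialDeriv_eqOn hopen
        (g := fun x => ∑ α ∈ w.support, polyFun (w α) x * multiDeriv α f (polyMap G x))
        (fun x hx => (h V hV f hf x hx).trans (evalOperator_apply _ _ _ _)) a hu, map_sum]
      have hsum : partialDeriv a
          (fun x => ∑ α ∈ w.support, polyFun (w α) x * multiDeriv α f (polyMap G x)) u =
          ∑ α ∈ w.support,
            partialDeriv a (fun x => polyFun (w α) x * multiDeriv α f (polyMap G x)) u := by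
        simp only [partialDeriv]
        rw [fderiv_fun_sum (A := fun α x => polyFun (w α) x * multiDeriv α f (polyMap G x)) fun α _ => (differentiableAt_polyFun (w α) u).mul (hd' α)]
        simp
      rw [hsum]
      refine Finset.sum_congr rfl fun α _ => ?_
      rw [partialDeriv_mul (differentiableAt_polyFun _ _) (hd' α), map_add, evalOperator_single,
        partialDeriv_polyFun, map_sum, partialDeriv_comp_polyMap G (hd α), Finset.mul_sum]
      congr 1
      refine Finset.sum_congr rfl fun i _ => ?_
      rw [evalOperator_single, partialDeriv_multiDeriv hV hf α i hu]
      simp only [polyFun, map_mul]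
      ring

lemma iterate_pderiv_X_pow (i k : Fin 2) (h : i ≠ k) (P : Poly2) (m n : ℕ) :
    (MvPolynomial.pderiv i)^[n] (MvPolynomial.X k ^ m * P) =
      MvPolynomial.X k ^ m * (MvPolynomial.pderiv i)^[n] P := by
  induction n with
  | zero => rfl
  | succ n ih =>
    rw [Function.iterate_succ_apply', ih, Derivation.leibniz, Derivation.leibniz_pow,
      MvPolynomial.pderiv_X_of_ne h.symm, Function.iterate_succ_apply']
    simp

lemma iterate_pderiv_X_pow_self (i : Fin 2) (m n : ℕ) :
    (MvPolynomial.pderiv i)^[n] (MvPolynomial.X i ^ m : Poly2) =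
      (m.descFactorial n : ℝ) • MvPolynomial.X i ^ (m - n) := by
  induction n with
  | zero => simp
  | succ n ih =>
    rw [Function.iterate_succ_apply', ih, Derivation.map_smul, Derivation.leibniz_pow,
      MvPolynomial.pderiv_X_self, Nat.descFactorial_succ, Nat.sub_sub]
    simp only [smul_eq_mul, mul_one, Nat.cast_smul_eq_nsmul, smul_smul]
    rw [mul_comm (m - n)]

lemma multiDeriv_monomial (α β : ℕ × ℕ) :
    multiDeriv β (polyFun (MvPolynomial.X 1 ^ α.2 * MvPolynomial.X 0 ^ α.1)) =
      fun x => (α.1.descFactorial β.1 * α.2.descFactorial β.2 : ℝ) *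
        (x 0 ^ (α.1 - β.1) * x 1 ^ (α.2 - β.2)) := by
  rw [multiDeriv_polyFun, mul_comm, iterate_pderiv_X_pow 1 0 (by decide),
    iterate_pderiv_X_pow_self, mul_smul_comm, mul_comm]
  have : ∀ (c : ℝ) (P : Poly2) n, (MvPolynomial.pderiv 0)^[n] (c • P) =
      c • (MvPolynomial.pderiv (0 : Fin 2))^[n] P := fun c P n => by
    induction n with
    | zero => rfl
    | succ n ih => rw [Function.iterate_succ_apply', ih, Derivation.map_smul, Function.iterate_succ_apply']
  rw [this, iterate_pderiv_X_pow 0 1 (by decide), iterate_pderiv_X_pow_self]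
  ext x
  simp only [polyFun, MvPolynomial.smul_eval, map_mul, map_pow, MvPolynomial.eval_X]
  ring

/-- An operator that annihilates the polynomials of degree less than `r` has no terms of order
less than `r`. -/
lemma operator_coeff_eq_zero {G : Fin 2 → Poly2} {w : ℕ × ℕ →₀ Poly2} {r : ℕ}
    (h : ∀ P : Poly2, P.totalDegree < r → ∀ u, evalOperator G (polyFun P) u w = 0)
    (α : ℕ × ℕ) (hα : α.1 + α.2 < r) : w α = 0 := by
  induction hn : α.1 + α.2 using Nat.strong_induction_on generalizing α with
  | _ n ih =>
    have hdeg : (MvPolynomial.X 1 ^ α.2 * MvPolynomial.X 0 ^ α.1 : Poly2).totalDegree < r := by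
      refine lt_of_le_of_lt ((MvPolynomial.totalDegree_mul _ _).trans ?_) hα
      rw [MvPolynomial.totalDegree_X_pow, MvPolynomial.totalDegree_X_pow, add_comm]
    refine polyFun_eq_zero_of_isOpen isOpen_univ univ_nonempty fun u _ => ?_
    have h0 := h _ hdeg u
    by_cases hmem : α ∈ w.support
    · rw [evalOperator_apply, Finset.sum_eq_single_of_mem α hmem] at h0
      · rw [multiDeriv_monomial] at h0
        simp only [Nat.descFactorial_self, Nat.sub_self, pow_zero, mul_one] at h0
        have : (α.1.factorial : ℝ) * (α.2.factorial : ℝ) ≠ 0 := by positivity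
        exact (mul_eq_zero.1 h0).resolve_right this
      -- Lower orders drop out by induction; any other `β` of order at least `|α|` exceeds `α` in
      -- one coordinate, so `∂^β` kills the monomial.
      · intro β _ hne
        by_cases hlt : β.1 + β.2 < n
        · rw [ih _ hlt β (by omega) rfl]
          simp [polyFun]
        · rw [multiDeriv_monomial]
          have : α.1 < β.1 ∨ α.2 < β.2 := by
            by_contra! hc
            exact hne (Prod.ext (by omega) (by omega))
          rcases this with h1 | h1 <;> simp [Nat.descFactorial_eq_zero_iff_lt.2 h1]
    · rw [Finsupp.notMem_support_iff.1 hmem]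
      simp [polyFun]

/-! ### Bounds on mapped dyadic squares -/

lemma exists_eLpNorm_polyFun_mul_le (Q : Poly2) : ∃ C : ℝ≥0∞, C ≠ ⊤ ∧
    ∀ b ⊆ unitSquare, IsOpen b → ∀ f : Plane → ℝ,
      eLpNorm (fun u => polyFun Q u * f u) 2 (volume.restrict b) ≤
        C * eLpNorm f 2 (volume.restrict b) := by
  obtain ⟨C, hC0, hC⟩ := exists_bound_polyFun Q isBounded_unitSquare
  refine ⟨ENNReal.ofReal C, ENNReal.ofReal_ne_top, fun b hb hbo f => ?_⟩
  refine eLpNorm_le_mul_eLpNorm_of_ae_le_mul ?_ 2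
  rw [ae_restrict_iff' hbo.measurableSet]
  refine Filter.Eventually.of_forall fun u hu => ?_
  rw [norm_mul]
  exact mul_le_mul_of_nonneg_right (hC u (hb hu)) (norm_nonneg _)

lemma aestronglyMeasurable_polyFun (P : Poly2) (μ : Measure Plane) :
    AEStronglyMeasurable (polyFun P) μ := (contDiff_polyFun P).continuous.aestronglyMeasurable

lemma exists_eLpNorm_polyFun_mul_le' (Q : Poly2) : ∃ C : ℝ≥0∞, C ≠ ⊤ ∧
    ∀ b ⊆ unitSquare, IsOpen b → ∀ P : Poly2,
      eLpNorm (polyFun (Q * P)) 2 (volume.restrict b) ≤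
        C * eLpNorm (polyFun P) 2 (volume.restrict b) := by
  obtain ⟨C, hC, h⟩ := exists_eLpNorm_polyFun_mul_le Q
  refine ⟨C, hC, fun b hb hbo P => ?_⟩
  have e : polyFun (Q * P) = fun u => polyFun Q u * polyFun P u := by ext u; simp [polyFun]
  rw [e]
  exact h b hb hbo _

/-- The coefficients are bounded on the unit square, the derivative costs `2 ^ k` by the inverse
inequality, and the term of order zero is absorbed by `1 ≤ 2 ^ k`. The new degree bound permits
iteration. -/
lemma exists_jacobianStep_bound (G : Fin 2 → Poly2) (s d : ℕ) :
    ∃ (C : ℝ≥0∞) (d' : ℕ), C ≠ ⊤ ∧ ∀ (j : Fin 2) (P : Poly2), P.totalDegree ≤ d →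
      (jacobianStep G s j P).totalDegree ≤ d' ∧
      ∀ k j₁ j₂, j₁ < 2 ^ k → j₂ < 2 ^ k →
        eLpNorm (polyFun (jacobianStep G s j P)) 2 (volume.restrict (dyadicSquare k j₁ j₂)) ≤
          C * ENNReal.ofReal (2 ^ k) *
            eLpNorm (polyFun P) 2 (volume.restrict (dyadicSquare k j₁ j₂)) := by
  set X : Fin 2 → Fin 2 → Poly2 := fun k j =>
    (jacobianPolyMatrix G).adjugate k j * jacobianPoly G with hX
  set Y : Fin 2 → Fin 2 → Poly2 := fun k j =>
    (s : ℝ) • ((jacobianPolyMatrix G).adjugate k j * MvPolynomial.pderiv k (jacobianPoly G)) with hY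
  have hstep : ∀ j P, jacobianStep G s j P =
      ∑ k, (X k j * MvPolynomial.pderiv k P + (-1 : ℝ) • (Y k j * P)) := fun j P => by
    simp only [jacobianStep, hX, hY]
    exact Finset.sum_congr rfl fun k _ => by rw [neg_one_smul, sub_eq_add_neg]
  obtain ⟨C₀, hC₀, hinv⟩ := exists_eLpNorm_pderiv_le d
  choose CX hCX hXb using fun k j => exists_eLpNorm_polyFun_mul_le' (X k j)
  choose CY hCY hYb using fun k j => exists_eLpNorm_polyFun_mul_le' (Y k j)
  refine ⟨∑ j, ∑ k, (CX k j * C₀ + CY k j),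
    ∑ j, ∑ k, ((X k j).totalDegree + (Y k j).totalDegree + d), ?_, fun j P hP => ⟨?_, ?_⟩⟩
  · refine (ENNReal.sum_lt_top.2 fun j _ => ENNReal.sum_lt_top.2 fun k _ => ?_).ne
    exact ENNReal.add_lt_top.2 ⟨ENNReal.mul_lt_top (hCX k j).lt_top hC₀.lt_top, (hCY k j).lt_top⟩
  · rw [hstep]
    refine MvPolynomial.totalDegree_finsetSum_le fun k _ => ?_
    refine le_trans ?_ (Finset.single_le_sum (f := fun j => ∑ k, ((X k j).totalDegree +
      (Y k j).totalDegree + d)) (fun _ _ => Nat.zero_le _) (Finset.mem_univ j))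
    refine le_trans ?_ (Finset.single_le_sum (f := fun k => ((X k j).totalDegree +
      (Y k j).totalDegree + d)) (fun _ _ => Nat.zero_le _) (Finset.mem_univ k))
    refine (MvPolynomial.totalDegree_add _ _).trans (max_le ?_ ?_)
    · have h1 := MvPolynomial.totalDegree_mul (X k j) (MvPolynomial.pderiv k P)
      have h2 := totalDegree_pderiv_le k P
      omega
    · have h1 := MvPolynomial.totalDegree_smul_le (-1 : ℝ) (Y k j * P)
      have h2 := MvPolynomial.totalDegree_mul (Y k j) P
      omega
  · intro k j₁ j₂ h₁ h₂
    set b := dyadicSquare k j₁ j₂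
    have hb : b ⊆ unitSquare := dyadicSquare_subset h₁ h₂
    have hbo : IsOpen b := isOpen_dyadicSquare _ _ _
    have h1k : 1 ≤ ENNReal.ofReal (2 ^ k) := by
      rw [← ENNReal.ofReal_one]
      exact ENNReal.ofReal_le_ofReal (one_le_pow₀ one_le_two)
    have hterm : ∀ i, eLpNorm (polyFun (X i j * MvPolynomial.pderiv i P + (-1 : ℝ) • (Y i j * P))) 2
        (volume.restrict b) ≤ (CX i j * C₀ + CY i j) * (ENNReal.ofReal (2 ^ k) *
          eLpNorm (polyFun P) 2 (volume.restrict b)) := by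
      intro i
      have e : polyFun (X i j * MvPolynomial.pderiv i P + (-1 : ℝ) • (Y i j * P)) =
          polyFun (X i j * MvPolynomial.pderiv i P) + (-1 : ℝ) • polyFun (Y i j * P) := by
        rw [polyFun_add, polyFun_smul]; rfl
      rw [e]
      refine (eLpNorm_add_le (aestronglyMeasurable_polyFun _ _)
        ((aestronglyMeasurable_polyFun _ _).const_smul _) (by norm_num)).trans ?_
      rw [eLpNorm_const_smul, add_mul]
      refine add_le_add ?_ ?_
      · refine (hXb i j b hb hbo _).trans ?_
        rw [mul_assoc, ← mul_assoc C₀]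
        exact mul_le_mul_right (hinv k j₁ j₂ P hP i) _
      · rw [enorm_neg, enorm_one, one_mul]
        refine (hYb i j b hb hbo _).trans (mul_le_mul_right ?_ _)
        exact le_mul_of_one_le_left zero_le h1k
    have hsum : polyFun (jacobianStep G s j P) =
        ∑ i, polyFun (X i j * MvPolynomial.pderiv i P + (-1 : ℝ) • (Y i j * P)) := by
      rw [hstep]
      ext u
      simp only [polyFun, map_sum, Finset.sum_apply]
    rw [hsum]
    refine (eLpNorm_sum_le (fun _ _ => aestronglyMeasurable_polyFun _ _) (by norm_num)).trans ?_
    refine (Finset.sum_le_sum fun i _ => hterm i).trans ?_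
    rw [← Finset.sum_mul, mul_assoc]
    refine mul_le_mul_left ?_ _
    exact Finset.single_le_sum (f := fun j => ∑ k, (CX k j * C₀ + CY k j))
      (fun _ _ => zero_le) (Finset.mem_univ j)

/-- The derivative of `f` in the coordinates of the parameterization, weighted by a power of the
Jacobian determinant that makes it a polynomial. -/
def weightedDeriv (G : Fin 2 → Poly2) (f : Plane → ℝ) (α : ℕ × ℕ) (u : Plane) : ℝ :=
  polyFun (jacobianPoly G) u ^ (2 * (α.1 + α.2) + 1) * multiDeriv α f (polyMap G u)

/-- One step raises the power of `J` by 2, which matches the exponent `2|α| + 1`; the extra 1 keeps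
the power positive, as `polyFun_jacobianStep` requires. -/
lemma weightedDeriv_step {G : Fin 2 → Poly2} {b : Set Plane} (hb : IsOpen b)
    (hV : IsOpen (polyMap G '' b)) {f : Plane → ℝ} (hf : ContDiffOn ℝ ∞ f (polyMap G '' b))
    {α : ℕ × ℕ} {P : Poly2} (hP : EqOn (polyFun P) (weightedDeriv G f α) b) (j : Fin 2) :
    EqOn (polyFun (jacobianStep G (2 * (α.1 + α.2) + 1) j P))
      (weightedDeriv G f (α + unitIndex j)) b := by
  intro u hu
  have hmem : ∀ u ∈ b, polyMap G u ∈ polyMap G '' b := fun u hu => mem_image_of_mem _ hu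
  rw [polyFun_jacobianStep hb (fun v hv => differentiableAt_of_contDiffOn hV
    (contDiffOn_multiDeriv hV hf α) (hmem v hv)) hP j hu,
    partialDeriv_multiDeriv hV hf α j (hmem u hu), weightedDeriv]
  congr 2
  fin_cases j <;> simp [unitIndex] <;> ring

lemma exists_eq_add_unitIndex {α : ℕ × ℕ} {n : ℕ} (h : α.1 + α.2 = n + 1) :
    ∃ β j, β.1 + β.2 = n ∧ α = β + unitIndex j := by
  obtain ⟨a, b⟩ := α
  rcases a with _ | a
  · rcases b with _ | b
    · simp at h
    · exact ⟨(0, b), 1, by simpa using h, by simp [unitIndex]⟩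
  · exact ⟨(a, b), 0, by simp only at h ⊢; omega, by simp [unitIndex]⟩

/-- The degree bound is uniform in the set and in `f`, so the same inverse inequality serves every
dyadic square and every approximant. -/
lemma exists_polynomial_weightedDeriv (G : Fin 2 → Poly2) (d n : ℕ) :
    ∃ d' : ℕ, ∀ b : Set Plane, IsOpen b → IsOpen (polyMap G '' b) → ∀ (f : Plane → ℝ) (R : Poly2),
      R.totalDegree ≤ d → ContDiffOn ℝ ∞ f (polyMap G '' b) →
      (∀ u ∈ b, f (polyMap G u) = polyFun R u) → ∀ α : ℕ × ℕ, α.1 + α.2 = n →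
      ∃ P : Poly2, P.totalDegree ≤ d' ∧ EqOn (polyFun P) (weightedDeriv G f α) b := by
  induction n with
  | zero =>
    refine ⟨(jacobianPoly G).totalDegree + d, fun b _ _ f R hR _ hfR α hα => ?_⟩
    refine ⟨jacobianPoly G * R, (MvPolynomial.totalDegree_mul _ _).trans (by omega),
      fun u hu => ?_⟩
    obtain rfl : α = (0, 0) := Prod.ext (by simp only; omega) (by simp only; omega)
    simp only [weightedDeriv, multiDeriv, Function.iterate_zero, id_eq, hfR u hu]
    simp [polyFun]
  | succ n ih =>
    obtain ⟨d₁, h₁⟩ := ih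
    obtain ⟨C, d', -, hstep⟩ := exists_jacobianStep_bound G (2 * n + 1) d₁
    refine ⟨d', fun b hb hV f R hR hf hfR α hα => ?_⟩
    obtain ⟨β, j, hβ, rfl⟩ := exists_eq_add_unitIndex hα
    obtain ⟨P, hP, hPeq⟩ := h₁ b hb hV f R hR hf hfR β hβ
    refine ⟨_, (hstep j P hP).1, ?_⟩
    rw [← hβ]
    exact weightedDeriv_step hb hV hf hPeq j

lemma eLpNorm_congr_eqOn {b : Set Plane} (hb : IsOpen b) {f g : Plane → ℝ} (h : EqOn f g b) :
    eLpNorm f 2 (volume.restrict b) = eLpNorm g 2 (volume.restrict b) :=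
  eLpNorm_congr_ae ((ae_restrict_iff' hb.measurableSet).2 (Filter.Eventually.of_forall h))

/-- Derivatives of order `r + m` are bounded by those of order `r`. -/
lemma exists_weightedDeriv_bound (G : Fin 2 → Poly2) (d r m : ℕ) :
    ∃ C : ℝ≥0∞, C ≠ ⊤ ∧ ∀ k j₁ j₂, j₁ < 2 ^ k → j₂ < 2 ^ k →
      IsOpen (polyMap G '' dyadicSquare k j₁ j₂) → ∀ (f : Plane → ℝ) (R : Poly2),
      R.totalDegree ≤ d → ContDiffOn ℝ ∞ f (polyMap G '' dyadicSquare k j₁ j₂) →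
      (∀ u ∈ dyadicSquare k j₁ j₂, f (polyMap G u) = polyFun R u) →
      ∀ α : ℕ × ℕ, α.1 + α.2 = r + m →
      eLpNorm (weightedDeriv G f α) 2 (volume.restrict (dyadicSquare k j₁ j₂)) ≤
        C * ENNReal.ofReal (2 ^ k) ^ m * ∑ γ ∈ Finset.HasAntidiagonal.antidiagonal r,
          eLpNorm (weightedDeriv G f γ) 2 (volume.restrict (dyadicSquare k j₁ j₂)) := by
  induction m with
  | zero =>
    refine ⟨1, ENNReal.one_ne_top, fun k j₁ j₂ _ _ _ f R _ _ _ α hα => ?_⟩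
    rw [one_mul, pow_zero, one_mul]
    exact Finset.single_le_sum (f := fun γ => eLpNorm (weightedDeriv G f γ) 2
      (volume.restrict (dyadicSquare k j₁ j₂))) (fun _ _ => zero_le)
      (Finset.HasAntidiagonal.mem_antidiagonal.2 hα)
  | succ m ih =>
    obtain ⟨C, hC, h⟩ := ih
    obtain ⟨d₁, hd₁⟩ := exists_polynomial_weightedDeriv G d (r + m)
    obtain ⟨C', d', hC', hstep⟩ := exists_jacobianStep_bound G (2 * (r + m) + 1) d₁
    refine ⟨C' * C, ENNReal.mul_ne_top hC' hC, fun k j₁ j₂ hj₁ hj₂ hV f R hR hf hfR α hα => ?_⟩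
    have hb := isOpen_dyadicSquare k j₁ j₂
    obtain ⟨β, j, hβ, rfl⟩ := exists_eq_add_unitIndex (n := r + m) hα
    obtain ⟨P, hP, hPeq⟩ := hd₁ _ hb hV f R hR hf hfR β hβ
    have h1 := (hstep j P hP).2 k j₁ j₂ hj₁ hj₂
    have h2 := weightedDeriv_step hb hV hf hPeq j
    rw [hβ] at h2
    rw [eLpNorm_congr_eqOn hb h2, eLpNorm_congr_eqOn hb hPeq] at h1
    refine h1.trans ((mul_le_mul_right (h k j₁ j₂ hj₁ hj₂ hV f R hR hf hfR β hβ) _).trans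
      (le_of_eq ?_))
    rw [pow_succ]
    ring

/-- Of the weight `J^(4r+2)` one factor is the density of the change of variables and the other `4r
+ 1` are bounded on the unit square. No positive lower bound for `|J|` enters. -/
lemma exists_weightedDeriv_sq_le (G : Fin 2 → Poly2) (r : ℕ) :
    ∃ C : ℝ≥0∞, C ≠ ⊤ ∧ ∀ b ⊆ unitSquare, IsOpen b → InjOn (polyMap G) b → ∀ (f : Plane → ℝ),
      ∀ γ ∈ Finset.HasAntidiagonal.antidiagonal r,
      eLpNorm (weightedDeriv G f γ) 2 (volume.restrict b) ^ 2 ≤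
        C * ∫⁻ x in polyMap G '' b, ‖multiDeriv γ f x‖ₑ ^ 2 := by
  obtain ⟨C, hC0, hC⟩ := exists_bound_polyFun (jacobianPoly G ^ (4 * r + 1)) isBounded_unitSquare
  refine ⟨ENNReal.ofReal C, ENNReal.ofReal_ne_top, fun b hb hbo hinj f γ hγ => ?_⟩
  rw [eLpNorm_two_sq, lintegral_image_eq_lintegral_abs_det_fderiv_mul volume hbo.measurableSet
    (fun u _ => (hasFDerivAt_polyMap G u).hasFDerivWithinAt) hinj,
    ← lintegral_const_mul' _ _ ENNReal.ofReal_ne_top]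
  refine setLIntegral_mono' hbo.measurableSet fun u hu => ?_
  have hγ' := Finset.HasAntidiagonal.mem_antidiagonal.1 hγ
  have h := hC u (hb hu)
  have e : polyFun (jacobianPoly G ^ (4 * r + 1)) u = polyFun (jacobianPoly G) u ^ (4 * r + 1) := by
    simp [polyFun]
  rw [e, norm_pow] at h
  rw [weightedDeriv, hγ', det_polyMapDeriv, ← polyFun_jacobianPoly, enorm_mul, mul_pow, ← mul_assoc]
  refine mul_le_mul_left ?_ _
  rw [enorm_pow, ← pow_mul, ← Real.enorm_eq_ofReal_abs, ← ofReal_norm,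
    ← ENNReal.ofReal_pow (norm_nonneg _), ← ENNReal.ofReal_mul hC0]
  refine ENNReal.ofReal_le_ofReal ?_
  calc ‖polyFun (jacobianPoly G) u‖ ^ ((2 * r + 1) * 2)
      = ‖polyFun (jacobianPoly G) u‖ ^ (4 * r + 1) * ‖polyFun (jacobianPoly G) u‖ := by
        rw [← pow_succ]; congr 1; ring
    _ ≤ _ := mul_le_mul_of_nonneg_right h (norm_nonneg _)

/-- Lower bound of the local error by a derivative that annihilates the local space. -/
lemma exists_iterate_pderiv_bound {G : Fin 2 → Poly2}
    (hreg : ∀ u ∈ unitSquare, (jacobianMatrix G u).det ≠ 0) (hinj : InjOn (polyMap G) unitSquare)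
    (a : Fin 2) (d r k : ℕ)
    (hvan : ∀ P : Poly2, P.totalDegree < r → ∀ u,
      (partialDeriv a)^[k] (fun x => polyFun P (polyMap G x)) u = 0) :
    ∃ C : ℝ≥0∞, C ≠ ⊤ ∧ ∀ l j₁ j₂, j₁ < 2 ^ l → j₂ < 2 ^ l → ∀ (f : Plane → ℝ) (R : Poly2),
      R.totalDegree ≤ d → (∀ u ∈ dyadicSquare l j₁ j₂, f (polyMap G u) = polyFun R u) →
      ∫⁻ u in dyadicSquare l j₁ j₂,
        ‖polyFun (jacobianPoly G ^ (2 * k + 1) * (MvPolynomial.pderiv a)^[k] R) u‖ₑ ^ 2 ≤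
      C * ENNReal.ofReal (((2 : ℝ) ^ l) ^ ((k : ℤ) - r)) ^ 2 *
        sobolevSemiSq r (polyMap G '' dyadicSquare l j₁ j₂) f := by
  obtain ⟨w, hw, hop⟩ := exists_operator_comp_polyMap G a k
  -- By `hvan` the operator annihilates all polynomials of degree below `r`, so only orders from `r`
  -- on occur.
  have hw0 : ∀ α ∈ w.support, r ≤ α.1 + α.2 := fun α hα => by
    by_contra! h
    refine Finsupp.mem_support_iff.1 hα (operator_coeff_eq_zero (G := G) (r := r) (fun P hP u => ?_) α h)
    rw [← hop univ isOpen_univ _ (contDiff_polyFun P).contDiffOn u (mem_univ _)]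
    exact hvan P hP u
  -- The factor `2(k - |α|)` is the part of the total weight `2k + 1` left after `2|α| + 1` has gone
  -- into `weightedDeriv`.
  set M : ℕ × ℕ → Poly2 := fun α => w α * jacobianPoly G ^ (2 * (k - (α.1 + α.2))) with hM
  choose CM hCM hMb using fun α => exists_eLpNorm_polyFun_mul_le (M α)
  choose CB hCB hBb using fun m => exists_weightedDeriv_bound G d r m
  obtain ⟨C₂, hC₂, h₂⟩ := exists_weightedDeriv_sq_le G r
  set C₁ := ∑ α ∈ w.support, CM α * CB (α.1 + α.2 - r) with hC₁
  have hC₁t : C₁ ≠ ⊤ := (ENNReal.sum_lt_top.2 fun α _ =>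
    ENNReal.mul_lt_top (hCM α).lt_top (hCB _).lt_top).ne
  refine ⟨C₁ ^ 2 * ((r + 1 : ℕ) : ℝ≥0∞) ^ 2 * C₂, ENNReal.mul_ne_top (ENNReal.mul_ne_top
    (ENNReal.pow_ne_top hC₁t) (ENNReal.pow_ne_top (ENNReal.natCast_ne_top _))) hC₂, ?_⟩
  intro l j₁ j₂ hj₁ hj₂ f R hR hfR
  set b := dyadicSquare l j₁ j₂
  have hb : b ⊆ unitSquare := dyadicSquare_subset hj₁ hj₂
  have hbo : IsOpen b := isOpen_dyadicSquare _ _ _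
  have hV : IsOpen (polyMap G '' b) := isOpen_image_polyMap hbo fun u hu => hreg u (hb hu)
  have hf : ContDiffOn ℝ ∞ f (polyMap G '' b) :=
    contDiffOn_of_comp_polyMap hbo (fun u hu => hreg u (hb hu)) (contDiff_polyFun R) hfR
  set Z := ENNReal.ofReal (((2 : ℝ) ^ l) ^ ((k : ℤ) - r)) with hZ
  set X := C₂ * sobolevSemiSq r (polyMap G '' b) f with hX
  have hγ : ∀ γ ∈ Finset.HasAntidiagonal.antidiagonal r,
      eLpNorm (weightedDeriv G f γ) 2 (volume.restrict b) ≤ X ^ (1 / 2 : ℝ) := fun γ hγ => by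
    have h := h₂ b hb hbo (hinj.mono hb) f γ hγ
    have hX' : C₂ * ∫⁻ x in polyMap G '' b, ‖multiDeriv γ f x‖ₑ ^ 2 ≤ X := by
      rw [hX, sobolevSemiSq_of_contDiffOn hV hf]
      exact mul_le_mul_right (Finset.single_le_sum
        (f := fun γ => ∫⁻ x in polyMap G '' b, ‖multiDeriv γ f x‖ₑ ^ 2)
        (fun _ _ => zero_le) hγ) _
    refine (ENNReal.pow_le_pow_left_iff (n := 2) (by norm_num)).1 ((h.trans hX').trans ?_)
    rw [← ENNReal.rpow_natCast, ← ENNReal.rpow_mul]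
    norm_num
  have hS : ∑ γ ∈ Finset.HasAntidiagonal.antidiagonal r,
      eLpNorm (weightedDeriv G f γ) 2 (volume.restrict b) ≤
      ((r + 1 : ℕ) : ℝ≥0∞) * X ^ (1 / 2 : ℝ) := by
    refine (Finset.sum_le_card_nsmul _ _ _ hγ).trans (le_of_eq ?_)
    rw [Finset.Nat.card_antidiagonal, nsmul_eq_mul]
  have hterm : ∀ α ∈ w.support,
      eLpNorm (fun u => polyFun (M α) u * weightedDeriv G f α u) 2 (volume.restrict b) ≤
        CM α * CB (α.1 + α.2 - r) * (Z * (((r + 1 : ℕ) : ℝ≥0∞) * X ^ (1 / 2 : ℝ))) := by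
    intro α hα
    have h1 := hw0 α hα
    refine (hMb α b hb hbo _).trans ?_
    have h2 := hBb (α.1 + α.2 - r) l j₁ j₂ hj₁ hj₂ hV f R hR hf hfR α (by omega)
    rw [mul_assoc]
    refine mul_le_mul_right (h2.trans ?_) _
    rw [mul_assoc]
    refine mul_le_mul_right (mul_le_mul' ?_ hS) _
    -- The worst power of `2 ^ l` is that of the top order, since `|α| - r ≤ k - r`.
    rw [hZ, ← ENNReal.ofReal_pow (by positivity), ← zpow_natCast]
    refine ENNReal.ofReal_le_ofReal (zpow_le_zpow_right₀ (one_le_pow₀ one_le_two) ?_)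
    have := hw α hα
    omega
  -- Nothing is known of `f` off the element; measurability comes from the polynomial that
  -- represents the weighted derivative.
  have hmeas : ∀ α ∈ w.support, AEStronglyMeasurable
      (fun u => polyFun (M α) u * weightedDeriv G f α u) (volume.restrict b) := fun α _ => by
    obtain ⟨d', hd'⟩ := exists_polynomial_weightedDeriv G d (α.1 + α.2)
    obtain ⟨P, -, hP⟩ := hd' b hbo hV f R hR hf hfR α rfl
    refine (aestronglyMeasurable_polyFun _ _).mul ((aestronglyMeasurable_polyFun P _).congr ?_)
    exact (ae_restrict_iff' hbo.measurableSet).2 (Filter.Eventually.of_forall hP)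
  have heq : EqOn (polyFun (jacobianPoly G ^ (2 * k + 1) * (MvPolynomial.pderiv a)^[k] R))
      (∑ α ∈ w.support, fun u => polyFun (M α) u * weightedDeriv G f α u) b := by
    intro u hu
    have e1 : polyFun ((MvPolynomial.pderiv a)^[k] R) u = evalOperator G f u w := by
      rw [← hop _ hV f hf u (mem_image_of_mem _ hu), ← iterate_partialDeriv_polyFun]
      exact (iterate_partialDeriv_eqOn hbo (fun x hx => hfR x hx) a k hu).symm
    have e2 : polyFun (jacobianPoly G ^ (2 * k + 1) * (MvPolynomial.pderiv a)^[k] R) u =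
        polyFun (jacobianPoly G) u ^ (2 * k + 1) *
          polyFun ((MvPolynomial.pderiv a)^[k] R) u := by simp [polyFun]
    rw [e2, e1, evalOperator_apply, Finset.mul_sum, Finset.sum_apply]
    refine Finset.sum_congr rfl fun α hα => ?_
    obtain ⟨m, hm⟩ := Nat.exists_eq_add_of_le (hw α hα)
    have e3 : polyFun (M α) u = polyFun (w α) u * polyFun (jacobianPoly G) u ^ (2 * m) := by
      rw [hM]
      simp only [polyFun, map_mul, map_pow]
      rw [hm, Nat.add_sub_cancel_left]
    rw [e3, weightedDeriv, hm]
    ring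
  rw [← eLpNorm_two_sq, eLpNorm_congr_eqOn hbo heq]
  have hfin : eLpNorm (∑ α ∈ w.support, fun u => polyFun (M α) u * weightedDeriv G f α u) 2
      (volume.restrict b) ≤ C₁ * (Z * (((r + 1 : ℕ) : ℝ≥0∞) * X ^ (1 / 2 : ℝ))) := by
    refine (eLpNorm_sum_le hmeas (by norm_num)).trans ((Finset.sum_le_sum hterm).trans ?_)
    rw [← Finset.sum_mul]
  refine (pow_le_pow_left' hfin 2).trans (le_of_eq ?_)
  have hX2 : (X ^ (1 / 2 : ℝ)) ^ 2 = X := by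
    rw [← ENNReal.rpow_natCast, ← ENNReal.rpow_mul]; norm_num
  rw [mul_pow, mul_pow, mul_pow, hX2, hX]
  ring

/-! ### Summation over dyadic squares -/

lemma dyadicSquare_ae_eq (k j₁ j₂ : ℕ) :
    dyadicSquare k j₁ j₂ =ᵐ[volume] Icc (![(j₁ : ℝ) / 2 ^ k, (j₂ : ℝ) / 2 ^ k] : Plane)
      ![((j₁ : ℝ) + 1) / 2 ^ k, ((j₂ : ℝ) + 1) / 2 ^ k] := by
  have e : dyadicSquare k j₁ j₂ = Set.pi univ fun i =>
      Ioo ((![(j₁ : ℝ) / 2 ^ k, (j₂ : ℝ) / 2 ^ k] : Plane) i)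
        ((![((j₁ : ℝ) + 1) / 2 ^ k, ((j₂ : ℝ) + 1) / 2 ^ k] : Plane) i) := by
    ext u
    simp [dyadicSquare, Fin.forall_fin_two, and_assoc]
  rw [e, volume_pi]
  exact Measure.univ_pi_Ioo_ae_eq_Icc

/-- The closed dyadic squares cover and differ from the open ones by null sets. Their overlaps do no
harm, as only an upper bound is claimed. -/
lemma lintegral_unitSquare_le (k : ℕ) (F : Plane → ℝ≥0∞) :
    ∫⁻ u in unitSquare, F u ≤
      ∑ j : Fin (2 ^ k) × Fin (2 ^ k), ∫⁻ u in dyadicSquare k j.1 j.2, F u := by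
  set K : Fin (2 ^ k) × Fin (2 ^ k) → Set Plane := fun j =>
    Icc (![((j.1 : ℕ) : ℝ) / 2 ^ k, ((j.2 : ℕ) : ℝ) / 2 ^ k] : Plane)
      ![(((j.1 : ℕ) : ℝ) + 1) / 2 ^ k, (((j.2 : ℕ) : ℝ) + 1) / 2 ^ k] with hK
  have hcover : unitSquare ⊆ ⋃ j, K j := by
    intro u hu
    have h2 : (0 : ℝ) < 2 ^ k := by positivity
    have hfl : ∀ x : ℝ, 0 < x → x < 1 → ∃ j : Fin (2 ^ k),
        ((j : ℕ) : ℝ) / 2 ^ k ≤ x ∧ x ≤ (((j : ℕ) : ℝ) + 1) / 2 ^ k := fun x h0 h1 => by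
      have hlt : ⌊x * 2 ^ k⌋₊ < 2 ^ k := by
        rw [Nat.floor_lt (by positivity)]
        push_cast
        exact mul_lt_of_lt_one_left h2 h1
      refine ⟨⟨_, hlt⟩, ?_, ?_⟩
      · rw [div_le_iff₀ h2]
        exact Nat.floor_le (by positivity)
      · rw [le_div_iff₀ h2]
        exact (Nat.lt_floor_add_one _).le
    obtain ⟨j₁, h1, h2⟩ := hfl (u 0) hu.1 hu.2.1
    obtain ⟨j₂, h3, h4⟩ := hfl (u 1) hu.2.2.1 hu.2.2.2
    refine mem_iUnion.2 ⟨(j₁, j₂), ?_⟩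
    simp only [hK, mem_Icc, Pi.le_def, Fin.forall_fin_two]
    exact ⟨⟨h1, h3⟩, ⟨h2, h4⟩⟩
  calc ∫⁻ u in unitSquare, F u ≤ ∫⁻ u in ⋃ j, K j, F u := lintegral_mono_set hcover
    _ ≤ ∑' j, ∫⁻ u in K j, F u := lintegral_iUnion_le _ _
    _ = ∑ j, ∫⁻ u in K j, F u := tsum_fintype _
    _ = _ := Finset.sum_congr rfl fun j _ =>
      setLIntegral_congr (dyadicSquare_ae_eq k j.1 j.2).symm

/-! ### Lower bound on the initial ring, and reproduction degrees -/

namespace SelfSimilarGeometry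

variable (D : SelfSimilarGeometry)

lemma polyFun_bind₁ (G : Fin 2 → Poly2) (P : Poly2) (u : Plane) :
    polyFun (MvPolynomial.bind₁ G P) u = polyFun P (polyMap G u) := by
  simp only [polyFun, ← MvPolynomial.coe_aeval_eq_eval, RingHom.coe_coe, MvPolynomial.aeval_bind₁]
  rfl

/-- The representing polynomial is determined by its values on the open square, so it must be the
formal substitution of `G` into `P`. -/
lemma polyFun_mem_element_iff (p : ℕ) (n : Fin D.N) (P : Poly2) :
    polyFun P ∈ (D.element p 0 n unitSquare).space ↔
      MvPolynomial.bind₁ (D.G n) P ∈ MvPolynomial.restrictDegree (Fin 2) ℝ p := by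
  constructor
  · rintro ⟨Q, hQ, h⟩
    have : MvPolynomial.bind₁ (D.G n) P - Q = 0 := by
      refine polyFun_eq_zero_of_isOpen isOpen_unitSquare unitSquare_nonempty fun u hu => ?_
      have e : polyFun (MvPolynomial.bind₁ (D.G n) P - Q) u =
          polyFun (MvPolynomial.bind₁ (D.G n) P) u - polyFun Q u := by simp [polyFun]
      rw [e, polyFun_bind₁, ← h u hu, D.param_zero, sub_self]
    rwa [sub_eq_zero.1 this]
  · intro h
    exact ⟨_, h, fun u _ => by rw [polyFun_bind₁, D.param_zero]⟩

/-- The error on the initial ring decays at most with the optimal rate, if the polynomials of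
degree less than `r` are reproduced on an element and `φ` is not. -/
lemma exists_ring_lower_bound (p r : ℕ) (n : Fin D.N)
    (hrep : ∀ P : Poly2, P.totalDegree < r → polyFun P ∈ (D.element p 0 n unitSquare).space)
    {φ : Poly2} (hφ : polyFun φ ∉ (D.element p 0 n unitSquare).space) :
    ∃ c : ℝ, 0 < c ∧ ∀ l : ℕ, ENNReal.ofReal (c * ((1 / 2 : ℝ) ^ l) ^ ((p : ℤ) + 1 - r)) ≤
      bestError r (D.ringMesh p 0 l) (polyFun φ) := by
  set G := D.G n with hG
  set Φ := MvPolynomial.bind₁ G φ with hΦ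
  rw [polyFun_mem_element_iff] at hφ
  obtain ⟨a, ha⟩ := exists_iterate_pderiv_ne_zero hφ
  have hvan : ∀ P : Poly2, P.totalDegree < r → ∀ u,
      (partialDeriv a)^[p + 1] (fun x => polyFun P (polyMap G x)) u = 0 := fun P hP u => by
    have h := (D.polyFun_mem_element_iff p n P).1 (hrep P hP)
    have e : (fun x => polyFun P (polyMap G x)) = polyFun (MvPolynomial.bind₁ G P) :=
      funext fun x => (polyFun_bind₁ G P x).symm
    rw [e, iterate_partialDeriv_polyFun, iterate_pderiv_eq_zero_of_mem_restrictDegree h]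
    simp [polyFun]
  -- The degree bound covers `Φ - Q` for every `Q` of degree at most `p` in each variable, whose
  -- total degree is at most `2 * p`.
  obtain ⟨C, hC, hbound⟩ := exists_iterate_pderiv_bound
    (fun u hu => D.det_jacobianMatrix_ne_zero n hu) (D.G_injOn n) a
    (max Φ.totalDegree (2 * p)) r (p + 1) hvan
  set T := jacobianPoly G ^ (2 * (p + 1) + 1) * (MvPolynomial.pderiv a)^[p + 1] Φ with hT
  have hT0 : T ≠ 0 := by
    refine mul_ne_zero (pow_ne_zero _ fun h => ?_) ha
    obtain ⟨u, hu⟩ := unitSquare_nonempty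
    have := D.det_jacobianMatrix_ne_zero n hu
    rw [← polyFun_jacobianPoly, h] at this
    simp [polyFun] at this
  set K := ∫⁻ u in unitSquare, ‖polyFun T u‖ₑ ^ 2 with hK
  have hK0 : K ≠ 0 := fun h => by
    refine sobolevNorm_polyFun_ne_zero hT0 isOpen_unitSquare unitSquare_nonempty 0 ?_
    have e : sobolevSemiSq 0 unitSquare (polyFun T) = K := by
      rw [sobolevSemiSq_of_contDiffOn isOpen_unitSquare (contDiff_polyFun T).contDiffOn]
      simp [multiDeriv, hK]
    rw [sobolevNorm, Finset.sum_range_one, e, h, ENNReal.zero_rpow_of_pos (by norm_num)]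
  have hmain : ∀ l : ℕ, ∀ f ∈ meshSpace (D.ringMesh p 0 l),
      K ≤ (C + 1) * ENNReal.ofReal (((2 : ℝ) ^ l) ^ ((p : ℤ) + 1 - r)) ^ 2 *
        brokenSemi r (D.ringMesh p 0 l) (fun x => polyFun φ x - f x) ^ 2 := by
    intro l f hf
    rw [brokenSemi_sq, Fintype.sum_prod_type, Finset.mul_sum]
    -- Only the pieces of the element `n` that does not reproduce `φ` are kept.
    refine le_trans ?_ (Finset.single_le_sum (fun _ _ => zero_le) (Finset.mem_univ n))
    rw [Finset.mul_sum]
    refine (lintegral_unitSquare_le l _).trans (Finset.sum_le_sum fun j _ => ?_)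
    obtain ⟨Q, hQ, hfQ⟩ := hf.2 (n, j)
    have hdeg : (Φ - Q).totalDegree ≤ max Φ.totalDegree (2 * p) := by
      refine (MvPolynomial.totalDegree_sub _ _).trans (max_le_max le_rfl ?_)
      refine Finset.sup_le fun s hs => ?_
      rw [Finsupp.sum_fintype _ _ (fun _ => rfl), Fin.sum_univ_two]
      have := (MvPolynomial.mem_restrictDegree _ _ _).1 hQ s hs
      have h0 := this 0
      have h1 := this 1
      omega
    -- `T` does not see the approximant, because `∂_a^(p+1)` annihilates `Q`.
    have hT' : T = jacobianPoly G ^ (2 * (p + 1) + 1) * (MvPolynomial.pderiv a)^[p + 1] (Φ - Q) := by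
      rw [iterate_map_sub, iterate_pderiv_eq_zero_of_mem_restrictDegree hQ, sub_zero]
    have h := hbound l j.1 j.2 j.1.2 j.2.2 (fun x => polyFun φ x - f x) (Φ - Q) hdeg
      (fun u hu => by
        have e : polyFun (Φ - Q) u = polyFun Φ u - polyFun Q u := by simp [polyFun]
        rw [e, ← hfQ u hu, polyFun_bind₁, D.param_zero])
    rw [← hT'] at h
    refine h.trans ?_
    have hdom : (D.ringMesh p 0 l (n, j)).dom = polyMap G '' dyadicSquare l j.1 j.2 := by
      rw [← D.param_zero]; rfl
    rw [hdom]
    push_cast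
    gcongr
    exact le_self_add
  have hC1 : C + 1 ≠ ⊤ := ENNReal.add_ne_top.2 ⟨hC, ENNReal.one_ne_top⟩
  have hC1' : C + 1 ≠ 0 := by simp
  -- `min K 1` makes the numerator finite and `C + 1` makes the denominator nonzero, so the quotient
  -- is a positive real number.
  have ht0 : min K 1 / (C + 1) ≠ 0 :=
    (ENNReal.div_pos (lt_min hK0.bot_lt zero_lt_one).ne' hC1).ne'
  have htt : min K 1 / (C + 1) ≠ ⊤ :=
    ENNReal.div_ne_top (ne_top_of_le_ne_top ENNReal.one_ne_top (min_le_right _ _)) hC1'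
  have htpos := ENNReal.toReal_pos ht0 htt
  refine ⟨√(min K 1 / (C + 1)).toReal, Real.sqrt_pos.2 htpos, fun l => le_iInf₂ fun f hf => ?_⟩
  refine (ENNReal.pow_le_pow_left_iff (n := 2) (by norm_num)).1 ?_
  have hz : 0 < ((2 : ℝ) ^ l) ^ ((p : ℤ) + 1 - r) := by positivity
  have hZ0 : ENNReal.ofReal (((2 : ℝ) ^ l) ^ ((p : ℤ) + 1 - r)) ^ 2 ≠ 0 :=
    pow_ne_zero _ (by simpa using hz)
  have hZt : ENNReal.ofReal (((2 : ℝ) ^ l) ^ ((p : ℤ) + 1 - r)) ^ 2 ≠ ⊤ :=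
    ENNReal.pow_ne_top ENNReal.ofReal_ne_top
  refine (ENNReal.mul_le_mul_iff_right (mul_ne_zero hC1' hZ0) (ENNReal.mul_ne_top hC1 hZt)).1 ?_
  refine le_trans ?_ (hmain l f hf)
  have e1 : ((1 / 2 : ℝ) ^ l) ^ ((p : ℤ) + 1 - r) = (((2 : ℝ) ^ l) ^ ((p : ℤ) + 1 - r))⁻¹ := by
    rw [one_div, inv_pow, inv_zpow]
  rw [e1, mul_assoc, ← mul_pow, ← ENNReal.ofReal_mul hz.le, mul_left_comm,
    mul_inv_cancel₀ hz.ne', mul_one, ← ENNReal.ofReal_pow (Real.sqrt_nonneg _),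
    Real.sq_sqrt htpos.le, ENNReal.ofReal_toReal htt, ENNReal.mul_div_cancel hC1' hC1]
  exact min_le_left _ _

/-- Every initial element reproduces the polynomials up to the minimal reproduction degree. -/
lemma polyFun_mem_of_isMinReproductionDegree {p κ : ℕ} (h : D.IsMinReproductionDegree p κ)
    (n : Fin D.N) {P : Poly2} (hP : P.totalDegree ≤ κ) :
    polyFun P ∈ (D.element p 0 n unitSquare).space := by
  set S := (D.element p 0 n unitSquare).reproducedDegrees with hS
  have hdown : ∀ k ∈ S, κ ≤ k → polyFun P ∈ (D.element p 0 n unitSquare).space := fun k hk hle =>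
    hk P ((MvPolynomial.mem_restrictTotalDegree _ _ _).2 (hP.trans hle))
  -- Constants are always reproduced, so a bounded set of degrees has a maximum, and minimality of
  -- `κ` applies to it. An unbounded set contains a degree above `κ` anyway.
  have hne : (0 : ℕ) ∈ S := fun Q hQ => by
    have hQ0 : Q.totalDegree = 0 := Nat.le_zero.1 ((MvPolynomial.mem_restrictTotalDegree _ _ _).1 hQ)
    rw [MvPolynomial.totalDegree_eq_zero_iff_eq_C] at hQ0
    rw [polyFun_mem_element_iff, hQ0, MvPolynomial.bind₁_C_right]
    refine MvPolynomial.restrictTotalDegree_le_restrictDegree _ _ p ?_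
    rw [MvPolynomial.mem_restrictTotalDegree]
    simp
  by_cases hb : BddAbove S
  · exact hdown _ (Nat.sSup_mem ⟨0, hne⟩ hb)
      (h.2 ⟨n, Nat.sSup_mem ⟨0, hne⟩ hb, fun k hk => le_csSup hb hk⟩)
  · obtain ⟨k, hk, hlt⟩ := not_bddAbove_iff.1 hb κ
    exact hdown k hk hlt.le

/-- Some initial element does not reproduce some homogeneous polynomial of the degree after the
minimal reproduction degree. -/
lemma exists_homogeneous_notMem {p κ : ℕ} (h : D.IsMinReproductionDegree p κ) :
    ∃ n, ∃ P ∈ MvPolynomial.homogeneousSubmodule (Fin 2) ℝ (κ + 1),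
      polyFun P ∉ (D.element p 0 n unitSquare).space := by
  obtain ⟨n, hn⟩ := h.1
  refine ⟨n, ?_⟩
  by_contra! hcon
  -- Splitting into homogeneous components, degree `κ + 1` would be reproduced on an element whose
  -- largest reproduced degree is `κ`.
  have hmem : κ + 1 ∈ (D.element p 0 n unitSquare).reproducedDegrees := fun P hP => by
    rw [MvPolynomial.mem_restrictTotalDegree] at hP
    obtain ⟨S, hS⟩ := D.exists_submodule_element p 0 n unitSquare
    have hsum := MvPolynomial.sum_homogeneousComponent P
    have e : polyFun P = ∑ i ∈ Finset.range (P.totalDegree + 1),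
        polyFun (MvPolynomial.homogeneousComponent i P) := by
      ext x
      conv_lhs => rw [← hsum]
      simp only [polyFun, map_sum, Finset.sum_apply]
    rw [hS, e]
    refine S.sum_mem fun i hi => ?_
    rw [← SetLike.mem_coe, ← hS]
    have hhom := MvPolynomial.homogeneousComponent_isHomogeneous i P
    rcases Nat.lt_or_ge κ i with hi' | hi'
    · obtain rfl : i = κ + 1 := by
        have := Finset.mem_range.1 hi
        omega
      exact hcon _ hhom
    · exact D.polyFun_mem_of_isMinReproductionDegree h n (hhom.totalDegree_le.trans hi')
  have := hn.2 hmem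
  omega

/-- Dropping the cap can only decrease the error; this transfers positivity from the ring to the
level-0 mesh. -/
lemma bestError_ringMesh_zero_le (p : ℕ) (W : Submodule ℝ (Plane → ℝ)) (r : ℕ) (φ : Plane → ℝ) :
    bestError r (D.ringMesh p 0 0) φ ≤ bestError r (D.globalMesh p W 0) φ := by
  refine le_bestError_globalMesh fun f hf => ?_
  have := bestError_sq_le (r := r) (φ := φ) (mem_meshSpace_ringMesh hf (i := 0) (by norm_num))
  exact this.trans (le_add_self.trans le_add_self)

end SelfSimilarGeometry

end

/-! ### The theorem -/

open Set Filter Topology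
open scoped ENNReal

theorem mainTheorem1 (D : SelfSimilarGeometry) (p : ℕ)
    (W : Submodule ℝ (Plane → ℝ)) (hWfin : FiniteDimensional ℝ W)
    (hWmem : ∀ s ∈ W, MeasureTheory.MemLp s 2 (MeasureTheory.volume.restrict (D.cap W 0).dom))
    (κ₀ : ℕ) (hκ₀ : D.IsMinReproductionDegree p κ₀)
    (hcap : κ₀ ∈ (D.cap W 0).reproducedDegrees)
    (r : ℕ) (hr : r ≤ κ₀ + 1)
    (A B : ℝ) (hA : A = D.lam ^ ((κ₀ : ℤ) + 2 - r)) (hB : B = 1 / 2 ^ ((p : ℤ) + 1 - r)) :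
    0 < D.extremalConst p κ₀ W r ∧ D.extremalConst p κ₀ W r < ⊤ ∧
    (∃ φ, D.IsExtremal p κ₀ W r φ) ∧
    ∀ φ, D.IsExtremal p κ₀ W r φ →
      ((∃ n, polyFun φ ∉ (D.element p 0 n unitSquare).space) →
        ∃ c : ℝ, 0 < c ∧ D.IsRingConst p κ₀ W r φ c) ∧
      (∀ c : ℝ, 0 ≤ c → D.IsRingConst p κ₀ W r φ c → ∀ l : ℕ,
        ENNReal.ofReal (min 1 c) * D.extremalConst p κ₀ W r *
            ENNReal.ofReal (√(∑ i ∈ Finset.range (l + 1), A ^ (2 * i) * B ^ (2 * (l - i)))) ≤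
          bestError r (D.globalMesh p W l) (polyFun φ)) ∧
      (∀ l : ℕ, D.extremalConst p κ₀ W r * ENNReal.ofReal (A ^ l) ≤
          bestError r (D.globalMesh p W l) (polyFun φ)) ∧
      (B < A → ¬ ∃ K : ℝ, ∀ l : ℕ,
          bestError r (D.globalMesh p W l) (polyFun φ) ≤ ENNReal.ofReal (K * B ^ l)) := by
  have hrep : ∀ n, ∀ P : Poly2, P.totalDegree < r →
      polyFun P ∈ (D.element p 0 n unitSquare).space := fun n P hP =>
    D.polyFun_mem_of_isMinReproductionDegree hκ₀ n (by omega)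
  have hpos : ∃ P ∈ MvPolynomial.homogeneousSubmodule (Fin 2) ℝ (κ₀ + 1),
      0 < bestError r (D.globalMesh p W 0) (polyFun P) := by
    obtain ⟨n, P, hP, hnot⟩ := D.exists_homogeneous_notMem hκ₀
    obtain ⟨c, hc, h⟩ := D.exists_ring_lower_bound p r n (hrep n) hnot
    refine ⟨P, hP, lt_of_lt_of_le ?_ ((h 0).trans (D.bestError_ringMesh_zero_le p W r _))⟩
    simpa using hc
  obtain ⟨hC0, hCt, hex⟩ := D.exists_isExtremal p κ₀ W r hpos
  refine ⟨hC0, hCt, hex, fun φ hφ => ?_⟩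
  set C := D.extremalConst p κ₀ W r with hC
  have hhom : ∀ (c : ℝ) x, polyFun φ (c • x) = c ^ (κ₀ + 1) * polyFun φ x :=
    polyFun_smul_of_homogeneous hφ.1
  have hE : bestError r (D.globalMesh p W 0) (polyFun φ) = C := hφ.2.2
  have hr' : r ≤ κ₀ + 1 + 1 := by omega
  have hA' : A = D.lam ^ (κ₀ + 1 + 1 - r) := by
    rw [hA, ← zpow_natCast, Nat.cast_sub hr']
    congr 1
  have hA0 : 0 < A := hA' ▸ D.lam_pow_pos _
  have hB0 : 0 < B := by rw [hB]; positivity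
  have hBl : ∀ l : ℕ, ((1 / 2 : ℝ) ^ l) ^ ((p : ℤ) + 1 - r) = B ^ l := fun l => by
    rw [hB, ← zpow_natCast, ← zpow_natCast, one_div, one_div, ← inv_zpow, zpow_comm]
  have hpow : ∀ l : ℕ, C * ENNReal.ofReal (A ^ l) ≤
      bestError r (D.globalMesh p W l) (polyFun φ) := fun l => by
    have h := SelfSimilarGeometry.pow_mul_bestError_le (D := D) (p := p) (W := W) hr' hhom l
    rw [hE, ← hA'] at h
    exact h
  refine ⟨?_, ?_, hpow, ?_⟩
  · rintro ⟨n, hn⟩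
    obtain ⟨c, hc, h⟩ := D.exists_ring_lower_bound p r n (hrep n) hn
    have hCr : 0 < C.toReal := ENNReal.toReal_pos hC0.ne' hCt.ne
    -- The ring bound is absolute; dividing by the extremal constant, positive and finite, gives the
    -- normalized form.
    refine ⟨c / C.toReal, div_pos hc hCr, fun l => ?_⟩
    refine le_trans (le_of_eq ?_) (h l)
    calc _ = ENNReal.ofReal (c / C.toReal * ((1 / 2 : ℝ) ^ l) ^ ((p : ℤ) + 1 - r)) *
          ENNReal.ofReal C.toReal := by rw [ENNReal.ofReal_toReal hCt.ne]
      _ = _ := by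
        rw [← ENNReal.ofReal_mul (by positivity)]
        congr 1
        field_simp
  · intro c hc hring l
    have := SelfSimilarGeometry.sqrt_sum_mul_bestError_le (D := D) (p := p) (W := W) hr' hhom hA' hB0.le hc
      (fun k => by rw [hE, ← hBl]; exact hring k) l
    rwa [hE] at this
  · rintro hBA ⟨K, hK⟩
    have hCr : 0 < C.toReal := ENNReal.toReal_pos hC0.ne' hCt.ne
    -- At this level `(A / B) ^ l` exceeds `K / C`, against `C * A ^ l ≤ K * B ^ l`.
    obtain ⟨l, hl⟩ := pow_unbounded_of_one_lt (K / C.toReal) ((one_lt_div hB0).2 hBA)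
    have h := (hpow l).trans (hK l)
    rw [← ENNReal.ofReal_toReal hCt.ne, ← ENNReal.ofReal_mul hCr.le] at h
    rw [div_pow, div_lt_div_iff₀ hCr (by positivity)] at hl
    have h2 := (ENNReal.ofReal_le_ofReal_iff').1 h
    rcases h2 with h2 | h2
    · linarith
    · have : 0 < C.toReal * A ^ l := by positivity
      linarith
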